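/- All rings are commutative with unit. **Conventions.** A *basic setup* $(R,I)$ is a ring $R$ with an ideal $I\subset R$ such that $I=I^2$ and $I$ is a flat $R$-module. Let $A$ be an $R$-algebra and $M$ an $A$-module; $I$ acts on $A$-modules through $R\to A$. - $M$ is *$I$-almost finitely generated* (resp. *$I$-almost finitely presented*) over $A$ if for every finitely generated ideal $I_0\subset R$ with $I_0\subset I$ there is a finitely generated $A$-submodule $N\subset M$ with $I_0M\subset N$ (resp. there is an $A$-linear map $N\to M$ with $N$ a finitely presented $A$-module whose kernel and cokernel are annihilated by $I_0$). - $M$ is *$I$-almost projective* over $A$ if for every surjection $X\to Y$ of $A$-modules the cokernel of $\mathrm{Hom}_A(M,X)\to \mathrm{Hom}_A(M,Y)$ is annihilated by $I$. It is *$I$-almost flat* over $A$ if for every injection $X\to Y$ of $A$-modules the kernel of $M\otimes_AX\to M\otimes_AY$ is annihilated by $I$. - A homomorphism of $R$-algebras $A\to B$ is *$I$-almost finite étale* if $B$ is $I$-almost flat and $I$-almost finitely presented as an $A$-module, and $B$ is $I$-almost projective as a $B\otimes_AB$-module via the multiplication map $B\otimes_AB\to B$. Let $f_0:A_0\to B_0$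 be a ring homomorphism and $I_0\subset A_0$, $J_0\subset B_0$ ideals. We say that $f_0:(A_0,I_0)\to (B_0,J_0)$ *satisfies $(*)$* if there is $t\in A_0$ with $I_0=tA_0$ and $J_0=tB_0$ such that - (a) $(A_0,I_0)$ is *preuniform*: there are a nonzerodivisor $s\in A_0$ with $I_0=sA_0$ and an integer $c>0$ such that $s^c x$ lies in the image of $A_0$ for every $x\in A_0[\frac1s]$ that is integral over $A_0$; - (b) the induced ring map $A_0[\frac1t]\to B_0[\frac1t]$ is finite étale; - (c) $B_0$ is $t$-torsion free, and every element $b$ of $B_0$ is almost integral over $A_0$ in $B_0[\frac1t]$, that is, $\sum_{n\ge 0}A_0b^n$ is contained in a finitely generated $A_0$-submodule of $B_0[\frac1t]$. **Theorem.** Let $(R,I)$ be a basic setup, let $f_0:A_0\to B_0$ be a homomorphism of $R$-algebras and let $t\in A_0$. Denote by $\widehat{A_0}=\varprojlim_n A_0/t^nA_0$ and $\widehat{B_0}=\varprojlim_n B_0/t^nB_0$ the $t$-adic completions and by $\widehat{f_0}:\widehat{A_0}\to\widehat{B_0}$ the $R$-algebra homomorphism induced by $f_0$. Assume that $f_0:(A_0,(t))\to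 (B_0,(t))$ satisfies $(*)$. Then: 1. $B_0$ is $I$-almost finitely generated and $I$-almost projective over $A_0$ if and only if $\widehat{B_0}$ is $I$-almost finitely generated and $I$-almost projective over $\widehat{A_0}$. 2. $f_0:A_0\to B_0$ is $I$-almost finite étale if and only if $\widehat{f_0}:\widehat{A_0}\to\widehat{B_0}$ is $I$-almost finite étale. -/

import Mathlib

open scoped TensorProduct

universe uR uA uB uM

namespace AlmostPurity

/-! ### Basic setups and almost modules -/

/-- A basic setup `(R, I)`: an ideal `I` with `I = I ^ 2` which is flat as an `R`-module. -/
structure IsBasicSetup {R : Type uR} [CommRing R] (I : Ideal R) : Prop where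
  idempotent : I = I ^ 2
  flat : Module.Flat R I

section Modules

variable {R : Type uR} [CommRing R] (I : Ideal R)
variable (A : Type uA) [CommRing A] [Algebra R A]
variable (M : Type uM) [AddCommGroup M] [Module A M]

/-- `M` is `I`-almost finitely generated over the `R`-algebra `A`: for every finitely generated
ideal `I₀ ⊆ I` there is a finitely generated submodule of `M` which contains `I₀ M`. -/
def IsAlmostFinitelyGenerated : Prop :=
  ∀ I₀ : Ideal R, I₀.FG → I₀ ≤ I →
    ∃ N : Submodule A M, N.FG ∧ ∀ ε ∈ I₀, ∀ m : M, algebraMap R A ε • m ∈ N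

/-- `M` is `I`-almost finitely presented over the `R`-algebra `A`: for every finitely generated
ideal `I₀ ⊆ I` there is a linear map from a finitely presented `A`-module to `M` whose kernel and
cokernel are annihilated by `I₀`. -/
def IsAlmostFinitelyPresented : Prop :=
  ∀ I₀ : Ideal R, I₀.FG → I₀ ≤ I →
    ∃ (N : Type uA) (_ : AddCommGroup N) (_ : Module A N) (φ : N →ₗ[A] M),
      Module.FinitePresentation A N ∧
      (∀ ε ∈ I₀, ∀ n : N, φ n = 0 → algebraMap R A ε • n = 0) ∧
      (∀ ε ∈ I₀, ∀ m : M, algebraMap R A ε • m ∈ LinearMap.range φ)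

/-- `M` is `I`-almost projective over the `R`-algebra `A`: the functor `Hom_A(M, -)` is exact up
to `I`-almost zero modules. Since it is left exact, this says that for every surjection `X → Y`
of `A`-modules the cokernel of `Hom_A(M, X) → Hom_A(M, Y)` is annihilated by `I`. -/
def IsAlmostProjective : Prop :=
  ∀ (X Y : Type (max uA uM)) [AddCommGroup X] [Module A X] [AddCommGroup Y] [Module A Y]
    (p : X →ₗ[A] Y), Function.Surjective p →
    ∀ g : M →ₗ[A] Y, ∀ ε ∈ I, ∃ h : M →ₗ[A] X, p ∘ₗ h = algebraMap R A ε • g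

/-- `M` is `I`-almost flat over the `R`-algebra `A`: the functor `M ⊗_A -` is exact up to
`I`-almost zero modules. Since it is right exact, this says that for every injection `X → Y`
of `A`-modules the kernel of `M ⊗_A X → M ⊗_A Y` is annihilated by `I`. -/
def IsAlmostFlat : Prop :=
  ∀ (X Y : Type (max uA uM)) [AddCommGroup X] [Module A X] [AddCommGroup Y] [Module A Y]
    (i : X →ₗ[A] Y), Function.Injective i →
    ∀ x : M ⊗[A] X, i.lTensor M x = 0 → ∀ ε ∈ I, algebraMap R A ε • x = 0

end Modules

/-! ### Almost finite étale homomorphisms -/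

section Algebras

variable {R : Type uR} [CommRing R] (I : Ideal R)
variable {A : Type uA} [CommRing A] [Algebra R A]
variable {B : Type uB} [CommRing B] [Algebra R B]

/-- `B` is `I`-almost finitely generated and `I`-almost projective as an `A`-module via
`f : A → B`. -/
def IsAlmostFinitelyGeneratedProjective (f : A →ₐ[R] B) : Prop :=
  letI := f.toRingHom.toAlgebra
  IsAlmostFinitelyGenerated I A B ∧ IsAlmostProjective I A B

/-- `f : A → B` is `I`-almost unramified: `B` is `I`-almost projective as a `B ⊗_A B`-module via
the multiplication map `B ⊗_A B → B`. -/
def IsAlmostUnramified (f : A →ₐ[R] B) : Prop :=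
  letI := f.toRingHom.toAlgebra
  haveI : IsScalarTower R A B := .of_algebraMap_eq fun r ↦ (f.commutes r).symm
  letI : Module (B ⊗[A] B) B := Module.compHom B (Algebra.TensorProduct.lmul' A (S := B)).toRingHom
  IsAlmostProjective I (B ⊗[A] B) B

/-- `f : A → B` is `I`-almost étale: it is `I`-almost flat and `I`-almost unramified. -/
def IsAlmostEtale (f : A →ₐ[R] B) : Prop :=
  letI := f.toRingHom.toAlgebra
  IsAlmostFlat I A B ∧ IsAlmostUnramified I f

/-- `f : A → B` is `I`-almost finite étale: it is `I`-almost étale and `B` is an `I`-almost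
finitely presented `A`-module. -/
def IsAlmostFiniteEtale (f : A →ₐ[R] B) : Prop :=
  letI := f.toRingHom.toAlgebra
  IsAlmostEtale I f ∧ IsAlmostFinitelyPresented I A B

end Algebras

/-! ### Preuniform pairs and the condition `(*)` -/

/-- `b : B` is almost integral over `A`: the `A`-module spanned by all powers of `b` is contained
in a finitely generated `A`-submodule of `B`. -/
def IsAlmostIntegralElement (A : Type uA) [CommRing A] {B : Type uB} [CommRing B] [Algebra A B]
    (b : B) : Prop :=
  ∃ N : Submodule A B, N.FG ∧ Submodule.span A (Set.range fun n : ℕ ↦ b ^ n) ≤ N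

/-- The pair `(A₀, I₀)` is preuniform: `I₀` is generated by a nonzerodivisor `t`, and
`t ^ c (A₀)⁺ ⊆ A₀` for some `c > 0`, where `(A₀)⁺` is the integral closure of `A₀` in
`A₀[1/t]`. -/
def IsPreuniform {A₀ : Type uA} [CommRing A₀] (I₀ : Ideal A₀) : Prop :=
  ∃ t ∈ nonZeroDivisors A₀, I₀ = Ideal.span {t} ∧ ∃ c : ℕ, 0 < c ∧
    ∀ x : Localization.Away t, IsIntegral A₀ x →
      ∃ a : A₀, algebraMap A₀ (Localization.Away t) a =
        algebraMap A₀ (Localization.Away t) t ^ c * x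

/-- The condition `(*)` for a homomorphism of pairs `f : (A₀, I₀) → (B₀, J₀)`. -/
def SatisfiesStar {A₀ : Type uA} [CommRing A₀] {B₀ : Type uB} [CommRing B₀] (f : A₀ →+* B₀)
    (I₀ : Ideal A₀) (J₀ : Ideal B₀) : Prop :=
  letI := f.toAlgebra
  ∃ t : A₀, I₀ = Ideal.span {t} ∧ J₀ = Ideal.span {f t} ∧
    IsPreuniform I₀ ∧
    ((Localization.awayMap f t).Finite ∧ (Localization.awayMap f t).Etale) ∧
    (∀ b : B₀, f t * b = 0 → b = 0) ∧
    ∀ b : B₀, IsAlmostIntegralElement A₀ (algebraMap B₀ (Localization.Away (f t)) b)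

/-! ### The map induced on completions -/

section Completion

variable {R : Type uR} [CommRing R]
variable {A₀ : Type uA} [CommRing A₀] [Algebra R A₀]
variable {B₀ : Type uB} [CommRing B₀] [Algebra R B₀]

theorem span_pow_le_comap (f : A₀ →ₐ[R] B₀) (t : A₀) (n : ℕ) :
    Ideal.span {t} ^ n ≤ (Ideal.span {f t} ^ n).comap f := by
  rw [Ideal.span_singleton_pow, Ideal.span_singleton_pow, Ideal.span_singleton_le_iff_mem,
    Ideal.mem_comap, map_pow]
  exact Ideal.mem_span_singleton_self _

/-- The homomorphism `lim A₀ / t ^ n → lim B₀ / t ^ n` of `t`-adic completions induced by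
`f : A₀ → B₀`. -/
noncomputable def completionMap (f : A₀ →ₐ[R] B₀) (t : A₀) :
    AdicCompletion (Ideal.span {t}) A₀ →ₐ[R] AdicCompletion (Ideal.span {f t}) B₀ :=
  AdicCompletion.liftAlgHom (Ideal.span {f t})
    (fun n ↦ (Ideal.quotientMapₐ (Ideal.span {f t} ^ n) f (span_pow_le_comap f t n)).comp
      ((AdicCompletion.evalₐ (Ideal.span {t}) n).restrictScalars R))
    (fun {m n} hle ↦ by
      ext x
      obtain ⟨x, rfl⟩ := AdicCompletion.mk_surjective _ _ x
      simp only [AlgHom.comp_apply, AlgHom.restrictScalars_apply, AdicCompletion.evalₐ_mk]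
      change Ideal.Quotient.mk _ (f _) = Ideal.Quotient.mk _ (f _)
      rw [Ideal.Quotient.eq, ← map_sub]
      refine span_pow_le_comap f t m ?_
      rw [← Ideal.Quotient.eq]
      exact AdicCompletion.Ideal.mk_eq_mk _ hle x)

end Completion

end AlmostPurity

/-! Both parts are translated into inclusions of `J = I A₀` in two ideals of the base ring. Being
almost finitely generated projective, and being almost flat and almost finitely presented, are each
equivalent to `J ≤ factorIdeal`; almost unramifiedness is equivalent to `J ≤ unramifiedIdeal`.
Idempotence of `I` is what allows a proof to lose a few factors from `I` along the way.

The condition `(*)` provides bounded denominators. The trace of the finite étale algebra `B₀[1/t]`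
sends `t b` to an element integral over `A₀` for `b ∈ B₀`, since `t b` is integral, and
preuniformity brings it into `A₀` after a further power of `t`. Dualising a separability idempotent
by the trace shows that `t ^ k` on `B₀` factors through a finite free module, and that a multiple by
a power of `t` of the idempotent comes from some `E` in `B₀ ⊗ B₀` (`exists_bounded_dual`).

Hence linear forms extend to the completion, and forms on the completion are approximated by forms
on `B₀`. An approximate factorization has an error divisible by `t ^ k`, and such an error factors
through a free module (`IsAdicSquare.comap_factorIdeal`). For the diagonal idempotent, `E` is almost
divisible by a power of `t` after completion; linear forms detect this before completion, and the
quotient is the element sought (`IsAdicSquare.le_unramifiedIdeal`). -/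

namespace AlmostPurity

/-! ### Almost finite projectivity as an inclusion of ideals -/

section FactorIdeal

variable (A : Type uA) [CommRing A] (M : Type uM) [AddCommGroup M] [Module A M]

/-- The ideal of those `a : A` such that multiplication by `a` on `M` factors through a finite
free `A`-module. -/
def factorIdeal : Ideal A where
  carrier := {a | ∃ (n : ℕ) (φ : Fin n → M →ₗ[A] A) (x : Fin n → M),
    ∀ m, ∑ j, φ j m • x j = a • m}
  zero_mem' := ⟨0, 0, 0, by simp⟩
  add_mem' := by
    rintro a b ⟨n, φ, x, h⟩ ⟨n', φ', x', h'⟩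
    refine ⟨n + n', Fin.append φ φ', Fin.append x x', fun m ↦ ?_⟩
    simp [Fin.sum_univ_add, h, h', add_smul]
  smul_mem' := by
    rintro c a ⟨n, φ, x, h⟩
    refine ⟨n, fun j ↦ c • φ j, x, fun m ↦ ?_⟩
    simp [mul_smul, ← h, Finset.smul_sum]

variable {A M}

theorem mem_factorIdeal_of_fintype {ι : Type*} [Fintype ι] {a : A} (φ : ι → M →ₗ[A] A) (x : ι → M)
    (h : ∀ m, ∑ j, φ j m • x j = a • m) : a ∈ factorIdeal A M := by
  refine ⟨Fintype.card ι, fun j ↦ φ ((Fintype.equivFin ι).symm j),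
    fun j ↦ x ((Fintype.equivFin ι).symm j), fun m ↦ ?_⟩
  rw [← h m]
  exact (Fintype.equivFin ι).symm.sum_comp (fun j ↦ φ j m • x j)

/-- An ideal contained in the square of itself is contained in every ideal containing the products
of two of its elements. -/
theorem le_of_mul_mem {R : Type*} [CommRing R] {I : Ideal R} (hI : I = I ^ 2) {J : Ideal R}
    (h : ∀ a ∈ I, ∀ b ∈ I, a * b ∈ J) : I ≤ J := by
  rw [hI, sq, Ideal.mul_le]
  exact fun a ha b hb ↦ h a ha b hb

theorem le_of_mul_mul_mem {R : Type*} [CommRing R] {I : Ideal R} (hI : I = I ^ 2) {J : Ideal R}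
    (h : ∀ a ∈ I, ∀ b ∈ I, ∀ c ∈ I, a * (b * c) ∈ J) : I ≤ J := by
  refine le_of_mul_mem hI fun a ha ↦ ?_
  exact le_of_mul_mem (J := Submodule.comap (LinearMap.mulLeft R a) J) hI fun b hb c hc ↦
    h a ha b hb c hc

variable {R : Type uR} [CommRing R] {I : Ideal R} [Algebra R A]

/-- Multiplication by `ε` lands in a finitely generated submodule, a quotient of `A ^ n`; almost
projectivity lifts `δ` times this map to `A ^ n`. So `ε * δ` factors, and such products suffice. -/
theorem le_comap_factorIdeal_of_almostProjective (hI : I = I ^ 2)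
    (hfg : IsAlmostFinitelyGenerated I A M) (hpr : IsAlmostProjective I A M) :
    I ≤ (factorIdeal A M).comap (algebraMap R A) := by
  refine le_of_mul_mem hI fun ε hε δ hδ ↦ ?_
  obtain ⟨N, hN, hεN⟩ := hfg (Ideal.span {ε}) ⟨{ε}, by simp⟩ (by simpa using hε)
  obtain ⟨n, s, rfl⟩ := Submodule.fg_iff_exists_fin_generating_family.mp hN
  have hεN' : ∀ m : M, algebraMap R A ε • m ∈ Submodule.span A (Set.range s) :=
    hεN ε (Ideal.mem_span_singleton_self ε)
  let g : M →ₗ[A] Submodule.span A (Set.range s) :=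
    (algebraMap R A ε • LinearMap.id).codRestrict _ hεN'
  let p : (Fin n → A) →ₗ[A] Submodule.span A (Set.range s) :=
    (Fintype.linearCombination A s).codRestrict _ fun c ↦ by
      rw [← Fintype.range_linearCombination]; exact LinearMap.mem_range_self _ _
  have hp : Function.Surjective p := by
    rintro ⟨y, hy⟩
    rw [← Fintype.range_linearCombination] at hy
    obtain ⟨c, rfl⟩ := hy
    exact ⟨c, rfl⟩
  -- The test modules of the definition live in `Type (max uA uM)`, hence the lifts.
  obtain ⟨h, hh⟩ := hpr (ULift.{uM} (Fin n → A)) (ULift.{uA} (Submodule.span A (Set.range s)))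
    (ULift.moduleEquiv.symm.toLinearMap ∘ₗ p ∘ₗ ULift.moduleEquiv.toLinearMap)
    (ULift.moduleEquiv.symm.surjective.comp (hp.comp ULift.moduleEquiv.surjective))
    (ULift.moduleEquiv.symm.toLinearMap ∘ₗ g) δ hδ
  refine ⟨n, fun j ↦ LinearMap.proj j ∘ₗ ULift.moduleEquiv.toLinearMap ∘ₗ h, s, fun m ↦ ?_⟩
  have := congrArg (fun y ↦ (y.down : M)) (LinearMap.congr_fun hh m)
  rw [map_mul, mul_comm, mul_smul]
  exact this

theorem almostFinitelyGenerated_of_le (h : I ≤ (factorIdeal A M).comap (algebraMap R A)) :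
    IsAlmostFinitelyGenerated I A M := by
  intro I₀ hfg hle
  obtain ⟨r, s, rfl⟩ := Submodule.fg_iff_exists_fin_generating_family.mp hfg
  have hs : ∀ i, algebraMap R A (s i) ∈ factorIdeal A M := fun i ↦
    h (hle (Submodule.subset_span ⟨i, rfl⟩))
  choose n φ x hx using hs
  refine ⟨Submodule.span A (Set.range fun q : Σ i, Fin (n i) ↦ x q.1 q.2),
    Submodule.fg_span (Set.finite_range _), fun ε hε m ↦ ?_⟩
  induction hε using Submodule.span_induction with
  | mem ε hε =>
    obtain ⟨i, rfl⟩ := hε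
    rw [← hx]
    exact Submodule.sum_mem _ fun j _ ↦ Submodule.smul_mem _ _ (Submodule.subset_span ⟨⟨i, j⟩, rfl⟩)
  | zero => simp
  | add a b _ _ ha hb => rw [map_add, add_smul]; exact Submodule.add_mem _ ha hb
  | smul c a _ ha => rw [smul_eq_mul, map_mul, mul_smul]; exact Submodule.smul_mem _ _ ha

theorem almostProjective_of_le (h : I ≤ (factorIdeal A M).comap (algebraMap R A)) :
    IsAlmostProjective I A M := by
  intro X Y _ _ _ _ p hp g ε hε
  obtain ⟨n, φ, x, hx⟩ := h hε
  choose y hy using fun j ↦ hp (g (x j))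
  refine ⟨∑ j, (φ j).smulRight (y j), ?_⟩
  ext m
  simp only [LinearMap.comp_apply, LinearMap.sum_apply, LinearMap.smulRight_apply, map_sum,
    map_smul, hy, LinearMap.smul_apply]
  rw [← map_smul, ← hx]
  simp

/-- Multiplication by `ε` on `M ⊗ X` factors through the maps `M ⊗ X → X` induced by the forms `φ
j`. These are natural in `X`, so they vanish on the kernel of `M ⊗ X → M ⊗ Y` when `X → Y` is
injective. -/
theorem almostFlat_of_le (h : I ≤ (factorIdeal A M).comap (algebraMap R A)) :
    IsAlmostFlat I A M := by
  intro X Y _ _ _ _ i hi z hz ε hε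
  obtain ⟨n, φ, x, hx⟩ := h hε
  have key : ∀ z : M ⊗[A] X,
      ∑ j, x j ⊗ₜ[A] TensorProduct.lid A X ((φ j).rTensor X z) = algebraMap R A ε • z := by
    intro z
    induction z with
    | zero => simp
    | tmul m w =>
      simp only [LinearMap.rTensor_tmul, TensorProduct.lid_tmul, TensorProduct.tmul_smul]
      rw [TensorProduct.smul_tmul', ← hx, TensorProduct.sum_tmul]
      simp [TensorProduct.smul_tmul']
    | add a b ha hb =>
      simp only [map_add, TensorProduct.tmul_add, Finset.sum_add_distrib, ha, hb, smul_add]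
  rw [← key]
  refine Finset.sum_eq_zero fun j _ ↦ ?_
  suffices TensorProduct.lid A X ((φ j).rTensor X z) = 0 by rw [this, TensorProduct.tmul_zero]
  apply hi
  have : ∀ z : M ⊗[A] X, i (TensorProduct.lid A X ((φ j).rTensor X z)) =
      TensorProduct.lid A Y ((φ j).rTensor Y (i.lTensor M z)) := by
    intro z
    induction z with
    | zero => simp
    | tmul m w => simp
    | add a b ha hb => simp only [map_add, ha, hb]
  rw [this, hz]
  simp

theorem almostFinitelyPresented_of_le (h : I ≤ (factorIdeal A M).comap (algebraMap R A)) :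
    IsAlmostFinitelyPresented I A M := by
  classical
  intro I₀ hfg hle
  obtain ⟨r, s, rfl⟩ := Submodule.fg_iff_exists_fin_generating_family.mp hfg
  have hs : ∀ i, algebraMap R A (s i) ∈ factorIdeal A M := fun i ↦
    h (hle (Submodule.subset_span ⟨i, rfl⟩))
  choose n φ x hx using hs
  let F := (Σ i, Fin (n i)) → A
  let v : F →ₗ[A] M := Fintype.linearCombination A fun q : Σ i, Fin (n i) ↦ x q.1 q.2
  let u (i : Fin r) : M →ₗ[A] F :=
    ∑ j, (φ i j).smulRight (Pi.single (⟨i, j⟩ : Σ i, Fin (n i)) (1 : A))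
  have hvu : ∀ i m, v (u i m) = algebraMap R A (s i) • m := by
    intro i m
    rw [← hx]
    simp only [u, v, LinearMap.sum_apply, LinearMap.smulRight_apply, map_sum, map_smul]
    refine Finset.sum_congr rfl fun j _ ↦ ?_
    rw [Fintype.linearCombination_apply_single, one_smul]
  -- These relations are finitely generated, being images of the finite free `F`. If `v c = 0`, the
  -- relation at `c` is `s i • c` itself, so `s i` kills the kernel of `F ⧸ W → M`.
  let W : Submodule A F := ⨆ i, LinearMap.range (algebraMap R A (s i) • LinearMap.id - u i ∘ₗ v)
  have hW : W ≤ LinearMap.ker v := by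
    refine iSup_le fun i ↦ ?_
    rintro _ ⟨c, rfl⟩
    rw [LinearMap.mem_ker, LinearMap.sub_apply, map_sub, LinearMap.comp_apply, hvu,
      LinearMap.smul_apply, map_smul, LinearMap.id_apply, sub_self]
  have hann : ∀ (p : R → Prop), p 0 → (∀ a b, p a → p b → p (a + b)) → (∀ c a, p a → p (c * a)) →
      (∀ i, p (s i)) → ∀ ε ∈ Submodule.span R (Set.range s), p ε := by
    intro p h0 ha hm hs ε hε
    induction hε using Submodule.span_induction with
    | mem ε hε => obtain ⟨i, rfl⟩ := hε; exact hs i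
    | zero => exact h0
    | add a b _ _ h1 h2 => exact ha _ _ h1 h2
    | smul c a _ h1 => exact hm _ _ h1
  refine ⟨F ⧸ W, inferInstance, inferInstance, W.liftQ v hW, ?_, ?_, ?_⟩
  · refine Module.finitePresentation_of_surjective W.mkQ W.mkQ_surjective ?_
    rw [Submodule.ker_mkQ]
    exact Submodule.fg_iSup _ fun i ↦ Module.Finite.fg_top.map _ |> fun h ↦ by
      simpa only [LinearMap.range_eq_map] using h
  · refine fun ε hε y hy ↦ hann (fun ε ↦ algebraMap R A ε • y = 0) (by simp)
      (fun a b ha hb ↦ by rw [map_add, add_smul, ha, hb, add_zero])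
      (fun c a ha ↦ by rw [map_mul, mul_smul, ha, smul_zero]) (fun i ↦ ?_) ε hε
    obtain ⟨c, rfl⟩ := W.mkQ_surjective y
    have hc : v c = 0 := by simpa using hy
    rw [← map_smul, ← LinearMap.mem_ker, Submodule.ker_mkQ]
    refine Submodule.mem_iSup_of_mem i ⟨c, ?_⟩
    simp [hc]
  · refine fun ε hε m ↦ hann (fun ε ↦ algebraMap R A ε • m ∈ LinearMap.range (W.liftQ v hW))
      (by simp) (fun a b ha hb ↦ by rw [map_add, add_smul]; exact add_mem ha hb)
      (fun c a ha ↦ by rw [map_mul, mul_smul]; exact Submodule.smul_mem _ _ ha) (fun i ↦ ?_) ε hε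
    exact ⟨W.mkQ (u i m), by simp [hvu]⟩

/-- Over an almost flat module, every solution of a finite system of linear equations is, up to
multiplication by a given element of `I`, a combination of solutions in the ring. -/
theorem IsAlmostFlat.exists_smul_eq (hfl : IsAlmostFlat I A M) {n m : ℕ}
    (T : (Fin n → A) →ₗ[A] (Fin m → A)) (x : Fin n → M)
    (hx : ∀ i, ∑ j, T (Pi.single j 1) i • x j = 0) {ε : R} (hε : ε ∈ I) :
    ∃ (l : ℕ) (k : Fin l → Fin n → A) (y : Fin l → M), (∀ q, T (k q) = 0) ∧
      ∀ j, algebraMap R A ε • x j = ∑ q, k q j • y q := by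
  classical
  let K := LinearMap.ker T
  let z : M ⊗[A] (Fin n → A) := ∑ j, x j ⊗ₜ Pi.single j 1
  have hz0 : T.lTensor M z = 0 := by
    simp only [z, map_sum, LinearMap.lTensor_tmul]
    have : ∀ j, T (Pi.single j 1) = ∑ i, T (Pi.single j 1) i • Pi.single i (1 : A) := by
      intro j
      exact (pi_eq_sum_univ' _)
    simp_rw [fun j ↦ congrArg (fun w ↦ x j ⊗ₜ[A] w) (this j), TensorProduct.tmul_sum]
    rw [Finset.sum_comm]
    refine Finset.sum_eq_zero fun i _ ↦ ?_
    simp_rw [← TensorProduct.smul_tmul]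
    rw [← TensorProduct.sum_tmul, hx, TensorProduct.zero_tmul]
  -- Almost flatness is applied to this injection: `ε • z` dies in `M ⊗ (A ^ n / K)`, so by right
  -- exactness it comes from `M ⊗ K`.
  let i₀ : ((Fin n → A) ⧸ K) →ₗ[A] (Fin m → A) := K.liftQ T le_rfl
  have hi₀ : Function.Injective i₀ := by
    rw [← LinearMap.ker_eq_bot]; exact Submodule.ker_liftQ_eq_bot _ _ _ le_rfl
  let up : ((Fin n → A) ⧸ K) →ₗ[A] ULift.{uM} ((Fin n → A) ⧸ K) :=
    ULift.moduleEquiv.symm.toLinearMap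
  have h1 := hfl (ULift.{uM} ((Fin n → A) ⧸ K)) (ULift.{uM} (Fin m → A))
    (ULift.moduleEquiv.symm.toLinearMap ∘ₗ i₀ ∘ₗ ULift.moduleEquiv.toLinearMap)
    (ULift.moduleEquiv.symm.injective.comp (hi₀.comp ULift.moduleEquiv.injective))
    ((up ∘ₗ K.mkQ).lTensor M z) (by
      rw [← LinearMap.comp_apply, ← LinearMap.lTensor_comp]
      have : (ULift.moduleEquiv.symm.toLinearMap ∘ₗ i₀ ∘ₗ ULift.moduleEquiv.toLinearMap) ∘ₗ
          up ∘ₗ K.mkQ = (ULift.moduleEquiv.symm.toLinearMap : _ →ₗ[A] ULift.{uM} (Fin m → A)) ∘ₗ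
            T := by
        ext; rfl
      rw [this, LinearMap.lTensor_comp, LinearMap.comp_apply, hz0, map_zero]) ε hε
  have h2 : K.mkQ.lTensor M (algebraMap R A ε • z) = 0 := by
    have := congrArg (LinearMap.lTensor M
      (ULift.moduleEquiv : ULift.{uM} ((Fin n → A) ⧸ K) ≃ₗ[A] _).toLinearMap) h1
    rw [map_smul, map_zero, ← LinearMap.comp_apply, ← LinearMap.lTensor_comp] at this
    rw [map_smul]
    exact this
  obtain ⟨w, hw⟩ := (lTensor_exact M (LinearMap.exact_subtype_mkQ K) K.mkQ_surjective _).mp h2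
  obtain ⟨l, y, k, rfl⟩ := TensorProduct.exists_sum_tmul_eq w
  refine ⟨l, fun q ↦ k q, y, fun q ↦ (k q).2, fun j ↦ ?_⟩
  have := congrArg (TensorProduct.rid A M ∘ (LinearMap.proj (R := A) (φ := fun _ : Fin n ↦ A) j).lTensor M) hw
  simpa [z, Pi.single_apply] using this.symm

/-- An almost version of the equational criterion: a map from a finitely presented `N` to `M` is a
solution in `M` of the relations of `N`, and solutions in `A` are linear forms on `N`. -/
theorem IsAlmostFlat.exists_factor (hfl : IsAlmostFlat I A M) {N : Type*} [AddCommGroup N]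
    [Module A N] [Module.FinitePresentation A N] (φ : N →ₗ[A] M) {ε : R} (hε : ε ∈ I) :
    ∃ (l : ℕ) (g : Fin l → N →ₗ[A] A) (y : Fin l → M),
      ∀ z, algebraMap R A ε • φ z = ∑ q, g q z • y q := by
  obtain ⟨n, K, e, hK⟩ := Module.FinitePresentation.exists_fin A N
  obtain ⟨m, r, rfl⟩ := Submodule.fg_iff_exists_fin_generating_family.mp hK
  set K := Submodule.span A (Set.range r)
  let x : Fin n → M := fun j ↦ φ (e.symm (K.mkQ (Pi.single j 1)))
  have hx : ∀ w : Fin n → A, φ (e.symm (K.mkQ w)) = ∑ j, w j • x j := by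
    intro w
    conv_lhs => rw [pi_eq_sum_univ' w]
    simp only [map_sum, map_smul, x]
  obtain ⟨l, k, y, hk, hy⟩ := hfl.exists_smul_eq
    (LinearMap.pi fun i ↦ Fintype.linearCombination A (r i)) x (fun i ↦ by
      have : K.mkQ (r i) = 0 := by
        rw [← LinearMap.mem_ker, Submodule.ker_mkQ]; exact Submodule.subset_span ⟨i, rfl⟩
      simpa [this] using (hx (r i)).symm) hε
  let g (q : Fin l) : ((Fin n → A) ⧸ K) →ₗ[A] A :=
    K.liftQ (Fintype.linearCombination A (k q)) (Submodule.span_le.mpr (by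
      rintro _ ⟨i, rfl⟩
      have := congrFun (hk q) i
      rw [SetLike.mem_coe, LinearMap.mem_ker, Fintype.linearCombination_apply]
      simpa [Fintype.linearCombination_apply, mul_comm] using this))
  refine ⟨l, fun q ↦ g q ∘ₗ e.toLinearMap, y, fun z ↦ ?_⟩
  obtain ⟨w, hw⟩ := K.mkQ_surjective (e z)
  obtain rfl : z = e.symm (K.mkQ w) := by rw [hw, e.symm_apply_apply]
  rw [hx, Finset.smul_sum]
  simp_rw [smul_comm (algebraMap R A ε), hy, Finset.smul_sum]
  rw [Finset.sum_comm]
  refine Finset.sum_congr rfl fun q _ ↦ ?_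
  simp only [smul_smul, ← Finset.sum_smul]
  congr 1
  simp [g, Fintype.linearCombination_apply]

theorem le_comap_factorIdeal_of_almostFlat (hI : I = I ^ 2)
    (hfl : IsAlmostFlat I A M) (hfp : IsAlmostFinitelyPresented I A M) :
    I ≤ (factorIdeal A M).comap (algebraMap R A) := by
  refine le_of_mul_mul_mem hI fun ε hε δ hδ γ hγ ↦ ?_
  obtain ⟨N, _, _, φ, hN, hker, hcoker⟩ := hfp (Ideal.span {γ, δ})
    (Submodule.fg_span (Set.toFinite _)) (by rw [Ideal.span_le]; rintro _ (rfl | rfl) <;> assumption)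
  replace hker := hker δ (Ideal.subset_span (by simp))
  choose n hn using hcoker γ (Ideal.subset_span (by simp))
  obtain ⟨l, g, y, hg⟩ := hfl.exists_factor φ hε
  -- An almost inverse of `φ`: `n m` is an arbitrary preimage of `γ • m`, and multiplying by `δ`,
  -- which kills the kernel, removes the ambiguity and makes the map linear.
  let ψ : M →ₗ[A] N :=
    { toFun m := algebraMap R A δ • n m
      map_add' m m' := by
        rw [← smul_add, ← sub_eq_zero, ← smul_sub]
        exact hker _ (by simp [hn])
      map_smul' c m := by
        rw [RingHom.id_apply, smul_comm, ← sub_eq_zero, ← smul_sub]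
        exact hker _ (by rw [map_sub, map_smul, hn, hn, smul_comm, sub_self]) }
  refine ⟨l, fun q ↦ g q ∘ₗ ψ, y, fun m ↦ ?_⟩
  have : φ (ψ m) = algebraMap R A (δ * γ) • m := by
    change φ (algebraMap R A δ • n m) = _
    rw [map_smul, hn, map_mul, mul_smul]
  simp only [LinearMap.comp_apply]
  rw [← hg, this, ← mul_smul, ← map_mul]

variable (I A M) in
theorem almostFinitelyGenerated_and_almostProjective_iff (hI : I = I ^ 2) :
    IsAlmostFinitelyGenerated I A M ∧ IsAlmostProjective I A M ↔
      I ≤ (factorIdeal A M).comap (algebraMap R A) :=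
  ⟨fun h ↦ le_comap_factorIdeal_of_almostProjective hI h.1 h.2,
    fun h ↦ ⟨almostFinitelyGenerated_of_le h, almostProjective_of_le h⟩⟩

variable (I A M) in
theorem almostFlat_and_almostFinitelyPresented_iff (hI : I = I ^ 2) :
    IsAlmostFlat I A M ∧ IsAlmostFinitelyPresented I A M ↔
      I ≤ (factorIdeal A M).comap (algebraMap R A) :=
  ⟨fun h ↦ le_comap_factorIdeal_of_almostFlat hI h.1 h.2,
    fun h ↦ ⟨almostFlat_of_le h, almostFinitelyPresented_of_le h⟩⟩

end FactorIdeal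

/-! ### Almost unramifiedness as an inclusion of ideals -/

section UnramifiedIdeal

open Algebra.TensorProduct

variable (A : Type uA) [CommRing A] (B : Type uB) [CommRing B] [Algebra A B]

/-- The ideal of those `a : A` which are the image under multiplication of an element of
`B ⊗[A] B` annihilated by the kernel of the multiplication map. -/
def unramifiedIdeal : Ideal A where
  carrier := {a | ∃ e : B ⊗[A] B, (∀ b : B, (b ⊗ₜ[A] 1) * e = (1 ⊗ₜ[A] b) * e) ∧
    lmul' A (S := B) e = algebraMap A B a}
  zero_mem' := ⟨0, by simp⟩
  add_mem' := by
    rintro a b ⟨e, he, h⟩ ⟨e', he', h'⟩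
    exact ⟨e + e', fun b ↦ by rw [mul_add, mul_add, he, he'], by simp [h, h']⟩
  smul_mem' := by
    rintro c a ⟨e, he, h⟩
    exact ⟨c • e, fun b ↦ by rw [mul_smul_comm, mul_smul_comm, he],
      by rw [map_smul, h, smul_eq_mul, map_mul, Algebra.smul_def]⟩

variable {A B}

theorem mul_eq_lmul'_tmul_mul {e : B ⊗[A] B}
    (he : ∀ b : B, (b ⊗ₜ[A] 1) * e = (1 ⊗ₜ[A] b) * e) (z : B ⊗[A] B) :
    z * e = (lmul' A (S := B) z ⊗ₜ[A] 1) * e := by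
  induction z with
  | zero => simp
  | tmul x y =>
    have h1 : x ⊗ₜ[A] y = (x ⊗ₜ[A] 1) * ((1 : B) ⊗ₜ[A] y) := by simp
    have h2 : (x * y) ⊗ₜ[A] (1 : B) = (x ⊗ₜ[A] 1) * (y ⊗ₜ[A] 1) := by simp
    rw [lmul'_apply_tmul, h1, h2, mul_assoc, mul_assoc, he]
  | add a b ha hb => rw [add_mul, ha, hb, map_add, TensorProduct.add_tmul, add_mul]

end UnramifiedIdeal

section AlgHom

variable {R : Type uR} [CommRing R] {I : Ideal R}
variable {A : Type uA} [CommRing A] [Algebra R A]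
variable {B : Type uB} [CommRing B] [Algebra R B] [Algebra A B] [IsScalarTower R A B]

/-- Lifting `ε • id` along the multiplication map gives a section up to `ε`, whose value at `1` is
the required element `e`. Conversely `b ↦ (b ⊗ 1) e x` lifts `ε • g` whenever `x` lifts `g 1`. -/
theorem almostProjective_tensorProduct_iff :
    letI : Module (B ⊗[A] B) B := Module.compHom B (Algebra.TensorProduct.lmul' A (S := B)).toRingHom
    IsAlmostProjective I (B ⊗[A] B) B ↔ I ≤ (unramifiedIdeal A B).comap (algebraMap R A) := by
  let : Module (B ⊗[A] B) B := Module.compHom B (Algebra.TensorProduct.lmul' A (S := B)).toRingHom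
  have smul_def : ∀ (z : B ⊗[A] B) (b : B), z • b = Algebra.TensorProduct.lmul' A (S := B) z * b :=
    fun _ _ ↦ rfl
  have hR : ∀ ε : R, algebraMap R (B ⊗[A] B) ε = algebraMap R A ε • 1 := fun ε ↦ by
    rw [algebraMap_smul, Algebra.algebraMap_eq_smul_one]
  constructor
  · intro h ε hε
    let μ : B ⊗[A] B →ₗ[B ⊗[A] B] B :=
      { toFun := Algebra.TensorProduct.lmul' A (S := B)
        map_add' := map_add _
        map_smul' := fun z w ↦ by rw [smul_eq_mul, map_mul]; rfl }
    have hμ : Function.Surjective μ := fun b ↦ ⟨b ⊗ₜ 1, by simp [μ]⟩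
    obtain ⟨s, hs⟩ := h (B ⊗[A] B) B μ hμ LinearMap.id ε hε
    refine ⟨s 1, fun b ↦ ?_, ?_⟩
    · rw [← smul_eq_mul, ← smul_eq_mul, ← map_smul, ← map_smul]
      simp [smul_def]
    · refine (LinearMap.congr_fun hs 1).trans ?_
      rw [LinearMap.smul_apply, LinearMap.id_apply, smul_def, mul_one, hR, map_smul, map_one,
        Algebra.smul_def, mul_one]
  · intro h X Y _ _ _ _ p hp g ε hε
    obtain ⟨e, he, hμ⟩ := h hε
    obtain ⟨x, hx⟩ := hp (g 1)
    have hmul := mul_eq_lmul'_tmul_mul he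
    refine ⟨{ toFun := fun b ↦ ((b ⊗ₜ[A] 1) * e) • x
              map_add' := fun a b ↦ by rw [TensorProduct.add_tmul, add_mul, add_smul]
              map_smul' := fun z b ↦ ?_ }, ?_⟩
    · rw [RingHom.id_apply, ← mul_smul, ← mul_assoc, hmul (z * _), smul_def, map_mul]
      simp
    · ext b
      change p (((b ⊗ₜ[A] 1) * e) • x) = algebraMap R (B ⊗[A] B) ε • g b
      rw [map_smul, hx, ← map_smul, ← map_smul]
      congr 1
      rw [smul_def, smul_def, hR, map_mul, hμ, map_smul, map_one, Algebra.smul_def]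
      simp [mul_comm]

end AlgHom

/-- A linear map whose pointwise values are divisible by a scalar acting injectively is divisible
by that scalar. -/
theorem exists_linearMap_smul_eq {A X Y : Type*} [CommRing A] [AddCommGroup X] [Module A X]
    [AddCommGroup Y] [Module A Y] {c : A} (hc : ∀ y : Y, c • y = 0 → y = 0) (g : X →ₗ[A] Y)
    (hg : ∀ x, ∃ y, g x = c • y) : ∃ h : X →ₗ[A] Y, ∀ x, g x = c • h x := by
  choose h hh using hg
  have inj : ∀ y y' : Y, c • y = c • y' → y = y' := fun y y' e ↦
    sub_eq_zero.mp (hc _ (by rw [smul_sub, e, sub_self]))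
  exact ⟨{ toFun := h
           map_add' := fun x y ↦ inj _ _ (by rw [smul_add, ← hh, ← hh, ← hh, map_add])
           map_smul' := fun a x ↦ inj _ _ (by
            rw [RingHom.id_apply, smul_comm, ← hh, ← hh, map_smul]) }, hh⟩

/-! ### Detecting elements of `B ⊗ B` by pairs of linear forms -/

section Pairing

variable {A : Type*} [CommRing A] {B : Type*} [CommRing B] [Algebra A B]

theorem algebraMap_tmul_one_mul (a : A) (z : B ⊗[A] B) :
    (algebraMap A B a ⊗ₜ[A] 1) * z = a • z := by
  rw [Algebra.algebraMap_eq_smul_one, ← TensorProduct.smul_tmul', smul_mul_assoc,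
    ← Algebra.TensorProduct.one_def, one_mul]

/-- The linear form on `B ⊗[A] B` given by two linear forms on `B`. -/
noncomputable def tensorForm (φ ψ : B →ₗ[A] A) : B ⊗[A] B →ₗ[A] A :=
  LinearMap.mul' A A ∘ₗ TensorProduct.map φ ψ

@[simp]
theorem tensorForm_tmul (φ ψ : B →ₗ[A] A) (x y : B) :
    tensorForm φ ψ (x ⊗ₜ y) = φ x * ψ y := by
  simp [tensorForm]

theorem sum_tensorForm_smul {a b : A} {ι κ : Type*} [Fintype ι] [Fintype κ]
    {φ : ι → B →ₗ[A] A} {x : ι → B} (hφ : ∀ m, ∑ j, φ j m • x j = a • m)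
    {ψ : κ → B →ₗ[A] A} {y : κ → B} (hψ : ∀ m, ∑ j, ψ j m • y j = b • m) (z : B ⊗[A] B) :
    ∑ i, ∑ j, tensorForm (φ i) (ψ j) z • (x i ⊗ₜ[A] y j) = (a * b) • z := by
  induction z with
  | zero => simp
  | tmul u v =>
    rw [← TensorProduct.smul_tmul_smul, ← hφ, ← hψ, TensorProduct.sum_tmul]
    simp_rw [TensorProduct.tmul_sum, tensorForm_tmul, TensorProduct.smul_tmul_smul]
  | add z w hz hw => simp only [map_add, add_smul, Finset.sum_add_distrib, hz, hw, smul_add]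

/-- If all linear forms of the shape `φ ⊗ ψ` take values in an ideal on `z`, then `z` lies in the
corresponding multiple of `B ⊗[A] B`, up to elements of an idempotent ideal through which `B`
almost factors. -/
theorem exists_smul_eq_of_tensorForm {J : Ideal A} (hJ : J = J ^ 2) (hJB : J ≤ factorIdeal A B)
    {c : A} {z : B ⊗[A] B} (h : ∀ φ ψ : B →ₗ[A] A, ∃ d, tensorForm φ ψ z = c * d) {ε : A}
    (hε : ε ∈ J) : ∃ w, ε • z = c • w := by
  suffices J ≤ Submodule.comap (LinearMap.toSpanSingleton A _ z)
      (LinearMap.range (LinearMap.lsmul A (B ⊗[A] B) c)) by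
    obtain ⟨w, hw⟩ := this hε
    exact ⟨w, hw.symm⟩
  refine le_of_mul_mem hJ fun a ha b hb ↦ ?_
  obtain ⟨n, φ, x, hφ⟩ := hJB ha
  obtain ⟨m, ψ, y, hψ⟩ := hJB hb
  rw [Submodule.mem_comap, LinearMap.toSpanSingleton_apply, ← sum_tensorForm_smul hφ hψ]
  refine Submodule.sum_mem _ fun i _ ↦ Submodule.sum_mem _ fun j _ ↦ ?_
  obtain ⟨d, hd⟩ := h (φ i) (ψ j)
  exact ⟨d • (x i ⊗ₜ y j), by rw [hd, mul_smul]; rfl⟩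

theorem smul_eq_zero_of_tensorForm {J : Ideal A} (hJ : J = J ^ 2) (hJB : J ≤ factorIdeal A B)
    {z : B ⊗[A] B} (h : ∀ φ ψ : B →ₗ[A] A, tensorForm φ ψ z = 0) {ε : A}
    (hε : ε ∈ J) : ε • z = 0 := by
  obtain ⟨w, hw⟩ := exists_smul_eq_of_tensorForm hJ hJB (c := 0) (z := z)
    (fun φ ψ ↦ ⟨0, by rw [h, mul_zero]⟩) hε
  rw [hw, zero_smul]

/-- `B ⊗ B` may have `c`-torsion, but forms with values in `A`, where `c` is regular, vanish on it;
hence it is almost zero. -/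
theorem smul_eq_zero_of_smul_eq_zero {J : Ideal A} (hJ : J = J ^ 2) (hJB : J ≤ factorIdeal A B)
    {c : A} (hc : ∀ a : A, c * a = 0 → a = 0) {z : B ⊗[A] B} (h : c • z = 0) {ε : A}
    (hε : ε ∈ J) : ε • z = 0 :=
  smul_eq_zero_of_tensorForm hJ hJB
    (fun φ ψ ↦ hc _ (by rw [← smul_eq_mul, ← map_smul, h, map_zero])) hε

end Pairing

/-! ### Base change of `B ⊗ B` along a square of rings -/

section Square

variable (A A' B B' : Type*) [CommRing A] [CommRing A'] [CommRing B] [CommRing B']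
variable [Algebra A B] [Algebra A A'] [Algebra B B'] [Algebra A' B'] [Algebra A B']
variable [IsScalarTower A A' B'] [IsScalarTower A B B']

/-- The map `B ⊗[A] B → B' ⊗[A'] B'` induced by a commutative square of rings. -/
noncomputable def tensorSquareMap : B ⊗[A] B →ₐ[A] B' ⊗[A'] B' :=
  Algebra.TensorProduct.lift
    (((Algebra.TensorProduct.includeLeft : B' →ₐ[A'] B' ⊗[A'] B').restrictScalars A).comp
      (IsScalarTower.toAlgHom A B B'))
    (((Algebra.TensorProduct.includeRight : B' →ₐ[A'] B' ⊗[A'] B').restrictScalars A).comp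
      (IsScalarTower.toAlgHom A B B')) (fun _ _ ↦ .all _ _)

@[simp]
theorem tensorSquareMap_tmul (x y : B) : tensorSquareMap A A' B B' (x ⊗ₜ y) =
    algebraMap B B' x ⊗ₜ[A'] algebraMap B B' y := by
  simp [tensorSquareMap]

theorem lmul'_tensorSquareMap (z : B ⊗[A] B) :
    Algebra.TensorProduct.lmul' A' (S := B') (tensorSquareMap A A' B B' z) =
      algebraMap B B' (Algebra.TensorProduct.lmul' A (S := B) z) := by
  induction z with
  | zero => simp
  | tmul x y => simp
  | add x y hx hy => simp [hx, hy]

variable {A A' B B'}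

theorem algebraMap_smul_of_square (a : A) (b : B) :
    algebraMap B B' (a • b) = algebraMap A A' a • algebraMap B B' b := by
  rw [Algebra.smul_def, map_mul, ← IsScalarTower.algebraMap_apply, algebraMap_smul,
    Algebra.smul_def]

theorem tensorForm_tensorSquareMap {φ ψ : B →ₗ[A] A} {φ' ψ' : B' →ₗ[A'] A'}
    (hφ : ∀ b, φ' (algebraMap B B' b) = algebraMap A A' (φ b))
    (hψ : ∀ b, ψ' (algebraMap B B' b) = algebraMap A A' (ψ b)) (z : B ⊗[A] B) :
    tensorForm φ' ψ' (tensorSquareMap A A' B B' z) = algebraMap A A' (tensorForm φ ψ z) := by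
  induction z with
  | zero => simp
  | tmul x y => simp [hφ, hψ]
  | add x y hx hy => simp [hx, hy]

/-- Forms on `B` extend to `B'`, so every `φ ⊗ ψ` vanishes on the kernel of `B ⊗ B → B' ⊗ B'`. This
makes identities valid after inverting `t` almost valid before. -/
theorem smul_eq_zero_of_tensorSquareMap {J : Ideal A} (hJ : J = J ^ 2)
    (hJB : J ≤ factorIdeal A B) (hinj : Function.Injective (algebraMap A A'))
    (hext : ∀ φ : B →ₗ[A] A, ∃ φ' : B' →ₗ[A'] A',
      ∀ b, φ' (algebraMap B B' b) = algebraMap A A' (φ b))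
    {z : B ⊗[A] B} (h : tensorSquareMap A A' B B' z = 0) {ε : A} (hε : ε ∈ J) : ε • z = 0 := by
  refine smul_eq_zero_of_tensorForm hJ hJB (fun φ ψ ↦ hinj ?_) hε
  obtain ⟨φ', hφ⟩ := hext φ
  obtain ⟨ψ', hψ⟩ := hext ψ
  rw [← tensorForm_tensorSquareMap hφ hψ, h, map_zero, map_zero]

end Square

/-! ### Comparison of the two ideals along an abstract completion -/

/-- `N'` looks like the `t`-adic completion of the `t`-torsion free module `N`. -/
structure IsAdicApproximation {A N N' : Type*} [CommRing A] [AddCommGroup N] [Module A N]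
    [AddCommGroup N'] [Module A N'] (t : A) (j : N →ₗ[A] N') : Prop where
  regular : ∀ x : N, t • x = 0 → x = 0
  regular' : ∀ x : N', t • x = 0 → x = 0
  approx : ∀ (n : ℕ) (x : N'), ∃ a y, x = j a + t ^ n • y
  detect : ∀ (n : ℕ) (a : N) (y : N'), j a = t ^ n • y → ∃ b, a = t ^ n • b

theorem eq_zero_of_pow_smul_eq_zero {A N : Type*} [CommRing A] [AddCommGroup N] [Module A N] {t : A}
    (h : ∀ x : N, t • x = 0 → x = 0) : ∀ (n : ℕ) (x : N), t ^ n • x = 0 → x = 0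
  | 0, x, hx => by simpa using hx
  | n + 1, x, hx => eq_zero_of_pow_smul_eq_zero h n x (h _ (by rwa [pow_succ', mul_smul] at hx))

section Approx

variable (A A' B B' : Type*) [CommRing A] [CommRing A'] [CommRing B] [CommRing B']
variable [Algebra A B] [Algebra A A'] [Algebra B B'] [Algebra A' B'] [Algebra A B']
variable [IsScalarTower A A' B'] [IsScalarTower A B B']

/-- A commutative square of rings `A → A'`, `B → B'` which looks like the `t`-adic completion of
`A → B`, where `B` embeds into a finite free `A`-module up to bounded `t`-torsion. -/
structure IsAdicSquare (t : A) : Prop where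
  left : IsAdicApproximation t (Algebra.linearMap A A')
  right : IsAdicApproximation t (IsScalarTower.toAlgHom A B B').toLinearMap
  bounded : ∃ (k n : ℕ) (l : Fin n → B →ₗ[A] A) (l' : Fin n → B' →ₗ[A'] A') (e : Fin n → B),
    (∀ i b, l' i (algebraMap B B' b) = algebraMap A A' (l i b)) ∧
    (∀ b, ∑ i, l i b • e i = t ^ k • b) ∧
    (∀ b, ∑ i, l' i b • algebraMap B B' (e i) = algebraMap A A' t ^ k • b)

variable {A A' B B'} {t : A} (H : IsAdicSquare A A' B B' t)
include H

namespace IsAdicSquare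

omit [IsScalarTower A A' B'] in
theorem eq_zero' (n : ℕ) (x : A') (h : algebraMap A A' t ^ n * x = 0) : x = 0 :=
  eq_zero_of_pow_smul_eq_zero H.left.regular' n x (by rwa [Algebra.smul_def, map_pow])

/-- The form `∑ φ (e i) • l' i` extends `t ^ k • φ`. Since `B'` is the image of `B` plus `t ^ k B'`,
its values are divisible by `t ^ k`. -/
theorem exists_extension (φ : B →ₗ[A] A) : ∃ φ' : B' →ₗ[A'] A',
    ∀ b, φ' (algebraMap B B' b) = algebraMap A A' (φ b) := by
  obtain ⟨k, n, l, l', e, hl, he, he'⟩ := H.bounded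
  let g : B' →ₗ[A'] A' := ∑ i, algebraMap A A' (φ (e i)) • l' i
  have hg : ∀ b, g (algebraMap B B' b) = algebraMap A A' t ^ k * algebraMap A A' (φ b) := by
    intro b
    rw [← map_pow, ← map_mul, ← smul_eq_mul, ← map_smul, ← he]
    simp only [g, LinearMap.sum_apply, LinearMap.smul_apply, hl, map_sum, map_smul, smul_eq_mul,
      map_mul, mul_comm]
  obtain ⟨h, hh⟩ := exists_linearMap_smul_eq (c := algebraMap A A' t ^ k)
    (fun y hy ↦ H.eq_zero' k y hy) g (fun b' ↦ by
      obtain ⟨b, b'', rfl⟩ := H.right.approx k b'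
      refine ⟨algebraMap A A' (φ b) + g b'', ?_⟩
      rw [map_add, ← algebraMap_smul A' (t ^ k), map_smul, smul_add, ← map_pow]
      congr 1
      exact (hg b).trans (by rw [map_pow, smul_eq_mul]))
  refine ⟨h, fun b ↦ ?_⟩
  rw [← sub_eq_zero]
  refine H.eq_zero' k _ ?_
  rw [mul_sub, ← hg, hh, smul_eq_mul, sub_self]

theorem exists_approximation (φ' : B' →ₗ[A'] A') (k : ℕ) : ∃ φ : B →ₗ[A] A,
    ∀ b, ∃ y, φ' (algebraMap B B' b) = algebraMap A A' (φ b) + algebraMap A A' t ^ k * y := by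
  obtain ⟨r, n, l, l', e, hl, he, -⟩ := H.bounded
  -- Precision `r + k` is needed because the form `∑ a i • l i` approximates `t ^ r • φ'` and is
  -- divided by `t ^ r` afterwards.
  choose a y hay using fun i ↦ H.left.approx (r + k) (φ' (algebraMap B B' (e i)))
  let g : B →ₗ[A] A := ∑ i, a i • l i
  have hg : ∀ b, algebraMap A A' t ^ r * φ' (algebraMap B B' b) =
      algebraMap A A' (g b) + algebraMap A A' t ^ (r + k) * ∑ i, algebraMap A A' (l i b) * y i := by
    intro b
    have h1 : algebraMap B B' (t ^ r • b) = algebraMap A A' t ^ r • algebraMap B B' b := by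
      rw [algebraMap_smul_of_square (A' := A'), map_pow]
    rw [← smul_eq_mul, ← map_smul, ← h1, ← he, map_sum, map_sum]
    have h2 : ∀ i, φ' (algebraMap B B' (l i b • e i)) =
        algebraMap A A' (l i b) * φ' (algebraMap B B' (e i)) := fun i ↦ by
      rw [algebraMap_smul_of_square (A' := A'), map_smul, smul_eq_mul]
    simp_rw [h2, hay, Algebra.smul_def]
    simp only [g, LinearMap.sum_apply, LinearMap.smul_apply, map_sum, smul_eq_mul, map_mul,
      Finset.mul_sum, ← Finset.sum_add_distrib, Algebra.linearMap_apply, map_pow]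
    exact Finset.sum_congr rfl fun i _ ↦ by ring
  obtain ⟨φ, hφ⟩ := exists_linearMap_smul_eq (c := t ^ r)
    (fun y hy ↦ eq_zero_of_pow_smul_eq_zero H.left.regular r y hy) g (fun b ↦ by
      refine H.left.detect r _ (φ' (algebraMap B B' b) -
        algebraMap A A' t ^ k * ∑ i, algebraMap A A' (l i b) * y i) ?_
      rw [Algebra.smul_def, map_pow, mul_sub, hg, Algebra.linearMap_apply]
      ring)
  refine ⟨φ, fun b ↦ ⟨∑ i, algebraMap A A' (l i b) * y i, ?_⟩⟩
  rw [← sub_eq_zero]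
  refine H.eq_zero' r _ ?_
  rw [mul_sub, hg, hφ, smul_eq_mul, map_mul, map_pow]
  ring

theorem comap_factorIdeal : (factorIdeal A' B').comap (algebraMap A A') = factorIdeal A B := by
  obtain ⟨k, n, l, l', e, hl, he, he'⟩ := H.bounded
  refine le_antisymm ?_ ?_
  · rintro a ⟨m, φ', x', h⟩
    choose φ hφ using fun j ↦ H.exists_approximation (φ' j) k
    choose x z hx using fun j ↦ H.right.approx k (x' j)
    let g : B →ₗ[A] B := a • LinearMap.id - ∑ j, (φ j).smulRight (x j)
    -- The error of the approximated factorization is `t ^ k • δ`. As `t ^ k` factors through a free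
    -- module by `he`, so does the error, with the forms `l i ∘ₗ δ`.
    obtain ⟨δ, hδ⟩ := exists_linearMap_smul_eq (c := t ^ k)
      (fun y hy ↦ eq_zero_of_pow_smul_eq_zero H.right.regular k y hy) g (fun b ↦ by
        choose y hy using fun j ↦ hφ j b
        refine H.right.detect k _ (∑ j, (algebraMap A A' (φ j b) • z j + y j • x' j)) ?_
        have hb := h (algebraMap B B' b)
        simp only [hy] at hb
        have h3 : algebraMap B B' (g b) = algebraMap A A' a • algebraMap B B' b -
            ∑ j, algebraMap A A' (φ j b) • algebraMap B B' (x j) := by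
          simp [g, algebraMap_smul_of_square (A' := A')]
        refine h3.trans ?_
        rw [← hb, ← Finset.sum_sub_distrib, Finset.smul_sum]
        refine Finset.sum_congr rfl fun j _ ↦ ?_
        rw [← algebraMap_smul A' (t ^ k), map_pow, add_smul]
        nth_rewrite 1 [hx j]
        simp only [AlgHom.toLinearMap_apply, IsScalarTower.coe_toAlgHom']
        rw [← algebraMap_smul A' (t ^ k), map_pow, smul_add, smul_add, mul_smul,
          smul_comm (algebraMap A A' (φ j b)) (algebraMap A A' t ^ k)]
        abel)
    refine mem_factorIdeal_of_fintype (Sum.elim φ fun i ↦ l i ∘ₗ δ) (Sum.elim x e) fun b ↦ ?_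
    simp only [Fintype.sum_sum_type, Sum.elim_inl, Sum.elim_inr, LinearMap.comp_apply, he, ← hδ]
    simp [g]
  · rintro a ⟨m, φ, x, h⟩
    choose φ' hφ using fun j ↦ H.exists_extension (φ j)
    refine ⟨m, φ', fun j ↦ algebraMap B B' (x j), fun b ↦ ?_⟩
    -- The identity may be checked after multiplying by `t ^ k`, where every element of `B'` becomes
    -- an `A'`-combination of images of the `e i`.
    have reg : ∀ z : B', algebraMap A A' t ^ k • z = 0 → z = 0 := fun z hz ↦
      eq_zero_of_pow_smul_eq_zero H.right.regular' k z (by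
        rwa [← map_pow, algebraMap_smul] at hz)
    rw [← sub_eq_zero]
    refine reg _ ?_
    have key : ∀ i, ∑ j, algebraMap A A' (φ j (e i)) • algebraMap B B' (x j) =
        algebraMap A A' a • algebraMap B B' (e i) := fun i ↦ by
      simpa [algebraMap_smul_of_square (A' := A')] using congrArg (algebraMap B B') (h (e i))
    rw [smul_sub, Finset.smul_sum]
    simp_rw [smul_smul, ← smul_eq_mul, ← map_smul, ← he']
    rw [smul_eq_mul, mul_comm, mul_smul, ← he']
    simp only [map_sum, map_smul, hφ, Finset.sum_smul, Finset.smul_sum]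
    rw [Finset.sum_comm, sub_eq_zero]
    refine Finset.sum_congr rfl fun i _ ↦ ?_
    simp_rw [smul_eq_mul, mul_smul]
    rw [← Finset.smul_sum, key, smul_comm]

/-- The image of `u` satisfies the commutation rule for elements of `B`, hence up to `t ^ k` for all
of `B'`. The remaining discrepancy is `t ^ k`-torsion, killed by a further factor `ε`. -/
theorem le_comap_unramifiedIdeal {J : Ideal A} (hJ : J = J ^ 2) (hJB : J ≤ factorIdeal A B)
    (h : J ≤ unramifiedIdeal A B) : J ≤ (unramifiedIdeal A' B').comap (algebraMap A A') := by
  refine le_of_mul_mem hJ fun ε hε c hc ↦ ?_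
  obtain ⟨k, n, l, l', e, hl, he, he'⟩ := H.bounded
  obtain ⟨u, hu, hμ⟩ := h hc
  have hJ' : J.map (algebraMap A A') = J.map (algebraMap A A') ^ 2 := by
    rw [← Ideal.map_pow, ← hJ]
  have hJB' : J.map (algebraMap A A') ≤ factorIdeal A' B' := by
    rwa [Ideal.map_le_iff_le_comap, H.comap_factorIdeal]
  set u' := tensorSquareMap A A' B B' u with hu'
  have hB : ∀ b : B, (algebraMap B B' b ⊗ₜ[A'] 1) * u' = (1 ⊗ₜ[A'] algebraMap B B' b) * u' := by
    intro b
    simpa using congrArg (tensorSquareMap A A' B B') (hu b)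
  refine ⟨algebraMap A A' ε • u', fun b ↦ ?_, ?_⟩
  · rw [mul_smul_comm, mul_smul_comm, ← sub_eq_zero, ← smul_sub]
    refine smul_eq_zero_of_smul_eq_zero hJ' hJB' (c := algebraMap A A' t ^ k) (H.eq_zero' k) ?_
      (Ideal.mem_map_of_mem _ hε)
    rw [smul_sub, sub_eq_zero, ← smul_mul_assoc, ← smul_mul_assoc, TensorProduct.smul_tmul',
      ← TensorProduct.tmul_smul, ← he', TensorProduct.sum_tmul, TensorProduct.tmul_sum,
      Finset.sum_mul, Finset.sum_mul]
    refine Finset.sum_congr rfl fun i _ ↦ ?_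
    rw [← TensorProduct.smul_tmul', TensorProduct.tmul_smul, smul_mul_assoc, smul_mul_assoc, hB]
  · rw [map_smul, hu', lmul'_tensorSquareMap, hμ, map_mul, map_mul, Algebra.smul_def,
      ← IsScalarTower.algebraMap_apply, ← IsScalarTower.algebraMap_apply A A' B',
      ← IsScalarTower.algebraMap_apply A B B']

/-- `E` plays the role of `t ^ K` times a separability idempotent. The point is to show that it is
almost divisible by `t ^ K` in `B ⊗ B`; the quotient `w` is then the desired element up to almost
zero torsion. -/
theorem le_unramifiedIdeal {J : Ideal A} (hJ : J = J ^ 2) (hJB : J ≤ factorIdeal A B)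
    {K : ℕ} {E : B ⊗[A] B} (hμE : Algebra.TensorProduct.lmul' A (S := B) E = algebraMap A B (t ^ K))
    (hE : ∀ ε ∈ J, ∀ b : B, ε • ((b ⊗ₜ[A] 1) * E) = ε • ((1 ⊗ₜ[A] b) * E))
    (h : J ≤ (unramifiedIdeal A' B').comap (algebraMap A A')) : J ≤ unramifiedIdeal A B := by
  obtain ⟨k, n, l, l', e, hl, he, he'⟩ := H.bounded
  have hJ' : J.map (algebraMap A A') = J.map (algebraMap A A') ^ 2 := by
    rw [← Ideal.map_pow, ← hJ]
  have hJB' : J.map (algebraMap A A') ≤ factorIdeal A' B' := by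
    rwa [Ideal.map_le_iff_le_comap, H.comap_factorIdeal]
  set E' := tensorSquareMap A A' B B' E with hE'
  have hB : ∀ ε ∈ J, ∀ b : B, algebraMap A A' ε • ((algebraMap B B' b ⊗ₜ[A'] 1) * E') =
      algebraMap A A' ε • ((1 ⊗ₜ[A'] algebraMap B B' b) * E') := by
    intro ε hε b
    simpa using congrArg (tensorSquareMap A A' B B') (hE ε hε b)
  have hB' : ∀ ε ∈ J, ∀ δ ∈ J, ∀ b : B', (b ⊗ₜ[A'] 1) * (algebraMap A A' (ε * δ) • E') =
      (1 ⊗ₜ[A'] b) * (algebraMap A A' (ε * δ) • E') := by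
    intro ε hε δ hδ b
    rw [mul_smul_comm, mul_smul_comm, ← sub_eq_zero, ← smul_sub, map_mul, mul_smul]
    refine smul_eq_zero_of_smul_eq_zero hJ' hJB' (c := algebraMap A A' t ^ k) (H.eq_zero' k) ?_
      (Ideal.mem_map_of_mem _ hε)
    have hL : algebraMap A A' t ^ k • ((b ⊗ₜ[A'] 1) * E') =
        ∑ i, l' i b • ((algebraMap B B' (e i) ⊗ₜ[A'] 1) * E') := by
      simp_rw [← smul_mul_assoc, TensorProduct.smul_tmul', ← he', TensorProduct.sum_tmul,
        Finset.sum_mul]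
    have hR : algebraMap A A' t ^ k • ((1 ⊗ₜ[A'] b) * E') =
        ∑ i, l' i b • ((1 ⊗ₜ[A'] algebraMap B B' (e i)) * E') := by
      simp_rw [← smul_mul_assoc, ← TensorProduct.tmul_smul, ← he', TensorProduct.tmul_sum,
        Finset.sum_mul]
    rw [smul_sub, smul_sub, sub_eq_zero, smul_comm, hL, smul_comm, hR, Finset.smul_sum,
      Finset.smul_sum]
    refine Finset.sum_congr rfl fun i _ ↦ ?_
    rw [smul_comm, hB δ hδ, smul_comm]
  have hform : ∀ c ∈ J, ∀ φ ψ : B →ₗ[A] A, ∃ d, tensorForm φ ψ (c • E) = t ^ K * d := by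
    intro c hc φ ψ
    suffices J ≤ Submodule.comap (LinearMap.mulRight A (tensorForm φ ψ E)) (Ideal.span {t ^ K}) by
      obtain ⟨d, hd⟩ := Ideal.mem_span_singleton'.mp (this hc)
      exact ⟨d, by rw [map_smul, mul_comm, hd]; rfl⟩
    refine le_of_mul_mul_mem hJ fun c hc ε hε δ hδ ↦ ?_
    obtain ⟨u, hu, hμu⟩ := h hc
    obtain ⟨φ', hφ⟩ := H.exists_extension φ
    obtain ⟨ψ', hψ⟩ := H.exists_extension ψ
    -- The product `u * E'` is computed in two ways: multiplication by `u` acts on the almost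
    -- central `E'` as `c`, and multiplication by `E'` acts on `u` as `t ^ K`.
    have h1 : tensorSquareMap A A' B B' ((c * (ε * δ)) • E) =
        algebraMap A A' t ^ K • (algebraMap A A' (ε * δ) • u) := by
      have h2 := mul_eq_lmul'_tmul_mul (hB' ε hε δ hδ) u
      have h3 := mul_eq_lmul'_tmul_mul hu (algebraMap A A' (ε * δ) • E')
      rw [hμu, algebraMap_tmul_one_mul] at h2
      rw [map_smul, hE', lmul'_tensorSquareMap, hμE, ← IsScalarTower.algebraMap_apply,
        IsScalarTower.algebraMap_apply A A' B', ← TensorProduct.smul_tmul', smul_mul_assoc,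
        smul_mul_assoc, algebraMap_tmul_one_mul, ← hE', mul_comm E' u, ← mul_smul_comm, h2] at h3
      rw [map_smul, ← hE', ← algebraMap_smul A', map_mul, mul_smul, h3, smul_comm, map_pow]
    obtain ⟨d, hd⟩ := H.left.detect K (tensorForm φ ψ ((c * (ε * δ)) • E))
      (tensorForm φ' ψ' (algebraMap A A' (ε * δ) • u)) (by
        rw [Algebra.linearMap_apply, ← tensorForm_tensorSquareMap hφ hψ, h1, map_smul,
          ← map_pow, algebraMap_smul])
    rw [Submodule.mem_comap, LinearMap.mulRight_apply, ← smul_eq_mul, ← map_smul, hd]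
    exact Ideal.mul_mem_right _ _ (Ideal.mem_span_singleton_self _)
  have regB : ∀ x y : B, t ^ K • x = t ^ K • y → x = y := fun x y hxy ↦
    sub_eq_zero.mp (eq_zero_of_pow_smul_eq_zero H.right.regular K _
      (by rw [smul_sub, hxy, sub_self]))
  refine le_of_mul_mul_mem hJ fun η hη q hq c hc ↦ ?_
  obtain ⟨w, hw⟩ := exists_smul_eq_of_tensorForm hJ hJB (hform c hc) hq
  refine ⟨η • w, fun b ↦ ?_, ?_⟩
  · rw [mul_smul_comm, mul_smul_comm, ← sub_eq_zero, ← smul_sub]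
    refine smul_eq_zero_of_smul_eq_zero hJ hJB
      (fun a ha ↦ eq_zero_of_pow_smul_eq_zero H.left.regular K a ha) ?_ hη
    rw [smul_sub, ← mul_smul_comm, ← mul_smul_comm, ← hw, mul_smul_comm, mul_smul_comm,
      mul_smul_comm, mul_smul_comm, hE c hc, sub_self]
  · have hw' := congrArg (Algebra.TensorProduct.lmul' A (S := B)) hw
    rw [map_smul, map_smul, map_smul, hμE] at hw'
    have hμw : algebraMap A B (q * c) = Algebra.TensorProduct.lmul' A (S := B) w :=
      regB _ _ (by rw [← hw']; simp only [Algebra.smul_def, map_mul]; ring)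
    rw [map_smul, ← hμw, Algebra.smul_def, ← map_mul]

end IsAdicSquare
end Approx

/-! ### Integrality of traces -/

section Trace

open Polynomial

/-- The values at `x` of monic polynomials form a multiplicative set. If it misses `0`, some prime
avoids it, and `x` is not integral modulo that prime. -/
theorem isIntegral_of_forall_prime {R S : Type*} [CommRing R] [CommRing S] [Algebra R S] (x : S)
    (h : ∀ P : Ideal S, P.IsPrime → IsIntegral R (Ideal.Quotient.mk P x)) : IsIntegral R x := by
  let T : Submonoid S :=
    { carrier := {y | ∃ p : R[X], p.Monic ∧ aeval x p = y}
      one_mem' := ⟨1, monic_one, by simp⟩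
      mul_mem' := by
        rintro _ _ ⟨p, hp, rfl⟩ ⟨q, hq, rfl⟩
        exact ⟨p * q, hp.mul hq, by simp⟩ }
  by_cases h0 : (0 : S) ∈ T
  · obtain ⟨p, hp, hx⟩ := h0
    exact ⟨p, hp, hx⟩
  · obtain ⟨P, hP, -, hdis⟩ := Ideal.exists_le_prime_disjoint ⊥ T
      (Set.disjoint_left.mpr fun y hy hyT ↦ h0 (by
        rw [SetLike.mem_coe, Ideal.mem_bot] at hy; rwa [← hy]))
    obtain ⟨p, hp, hx⟩ := h P hP
    refine absurd (⟨p, hp, rfl⟩ : aeval x p ∈ T) (Set.disjoint_left.mp hdis ?_)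
    rw [SetLike.mem_coe, ← Ideal.Quotient.eq_zero_iff_mem]
    change aeval (Ideal.Quotient.mkₐ R P x) p = 0 at hx
    rwa [aeval_algHom_apply] at hx

variable {R : Type*} [CommRing R] {n : Type*} [Fintype n] [DecidableEq n]

/-- The trace is the sum of the eigenvalues, and each eigenvalue is a root of any monic polynomial
annihilating the matrix. -/
theorem isIntegral_trace_of_isAlgClosed {L : Type*} [Field L] [IsAlgClosed L] [Algebra R L]
    {Ψ : Matrix n n L} (h : IsIntegral R Ψ) : IsIntegral R Ψ.trace := by
  obtain ⟨p, hp, hΨ⟩ := h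
  rw [Matrix.trace_eq_sum_roots_charpoly]
  refine multiset_sum_mem (S := integralClosure R L) _ fun r hr ↦ ⟨p, hp, ?_⟩
  have hr' := Matrix.mem_spectrum_iff_isRoot_charpoly.mpr (isRoot_of_mem_roots hr)
  have h1 := spectrum.subset_polynomial_aeval Ψ (p.map (algebraMap R L)) ⟨r, hr', rfl⟩
  have h2 : aeval Ψ (p.map (algebraMap R L)) = 0 := by
    rw [aeval_map_algebraMap]; exact hΨ
  have : Nontrivial (Matrix n n L) := by
    by_contra hne
    rw [not_nontrivial_iff_subsingleton] at hne
    exact (spectrum.of_subsingleton (R := L) Ψ ▸ hr' : r ∈ (∅ : Set L))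
  rw [h2, spectrum.zero_eq, Set.mem_singleton_iff] at h1
  exact (eval_map _ _).symm.trans h1

/-- The trace of a matrix which is integral over `R` is integral over `R`. -/
theorem isIntegral_trace {S : Type*} [CommRing S] [Algebra R S]
    {Ψ : Matrix n n S} (h : IsIntegral R Ψ) : IsIntegral R Ψ.trace := by
  refine isIntegral_of_forall_prime _ fun P hP ↦ ?_
  let L := AlgebraicClosure (FractionRing (S ⧸ P))
  let j : (S ⧸ P) →ₐ[R] L := IsScalarTower.toAlgHom R (S ⧸ P) L
  have hj : Function.Injective j :=
    (algebraMap (FractionRing (S ⧸ P)) L).injective.comp (IsFractionRing.injective (S ⧸ P) _)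
  let q : S →ₐ[R] L := j.comp (Ideal.Quotient.mkₐ R P)
  rw [← isIntegral_algHom_iff j hj]
  have := isIntegral_trace_of_isAlgClosed (h.map q.mapMatrix)
  rwa [AlgHom.mapMatrix_apply, ← AddMonoidHom.map_trace] at this

end Trace

/-! ### Traces and dual bases of finite étale algebras -/

section DualBasis

open Polynomial

variable {A B : Type*} [CommRing A] [CommRing B] [Algebra A B] {n : ℕ}

/-- The matrix of multiplication by `b` with respect to a pair of families which is, in
applications, a dual basis. -/
def mulMatrix (l : Fin n → B →ₗ[A] A) (e : Fin n → B) (b : B) : Matrix (Fin n) (Fin n) A :=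
  .of fun i j ↦ l i (b * e j)

/-- The trace form of a projective algebra in terms of a dual basis. -/
noncomputable def dualTrace (l : Fin n → B →ₗ[A] A) (e : Fin n → B) : B →ₗ[A] A :=
  ∑ i, l i ∘ₗ LinearMap.mulRight A (e i)

variable {l : Fin n → B →ₗ[A] A} {e : Fin n → B}

theorem dualTrace_apply (b : B) : dualTrace l e b = ∑ i, l i (b * e i) := by
  simp [dualTrace]

theorem mulMatrix_mul (h : ∀ b, ∑ i, l i b • e i = b) (b c : B) :
    mulMatrix l e b * mulMatrix l e c = mulMatrix l e (b * c) := by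
  ext i j
  simp only [Matrix.mul_apply, mulMatrix, Matrix.of_apply]
  conv_rhs => rw [mul_assoc, ← h (c * e j), Finset.mul_sum, map_sum]
  simp [mul_comm]

theorem isIntegral_mulMatrix {R : Type*} [CommRing R] [Algebra R A] [Algebra R B]
    [IsScalarTower R A B] (h : ∀ b, ∑ i, l i b • e i = b) {b : B} (hb : IsIntegral R b) :
    IsIntegral R (mulMatrix l e b) := by
  have add : ∀ b c, mulMatrix l e (b + c) = mulMatrix l e b + mulMatrix l e c := fun b c ↦ by
    ext; simp [mulMatrix, add_mul]
  have smul : ∀ (r : R) c, mulMatrix l e (r • c) = r • mulMatrix l e c := fun r c ↦ by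
    ext i j
    simp only [mulMatrix, Matrix.of_apply, Matrix.smul_apply, smul_mul_assoc]
    rw [← algebraMap_smul A r, map_smul, algebraMap_smul]
  have key : ∀ p : R[X], mulMatrix l e b * aeval (mulMatrix l e b) p =
      mulMatrix l e (b * aeval b p) := by
    intro p
    induction p using Polynomial.induction_on with
    | C a => simp [Algebra.algebraMap_eq_smul_one, smul]
    | add p q hp hq => rw [map_add, map_add, mul_add, mul_add, add, hp, hq]
    | monomial k a hk =>
      rw [pow_succ, ← mul_assoc, map_mul _ (C a * X ^ k), map_mul _ (C a * X ^ k), ← mul_assoc,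
        ← mul_assoc, hk, aeval_X, aeval_X, mulMatrix_mul h]
  obtain ⟨p, hp, hpb⟩ := hb
  -- `mulMatrix` is multiplicative but need not send `1` to the identity, so `p` itself need not
  -- annihilate the matrix; the extra factor `X` repairs this.
  refine ⟨X * p, monic_X.mul hp, ?_⟩
  change aeval _ _ = _
  change aeval b p = 0 at hpb
  rw [map_mul, aeval_X, key, hpb, mul_zero]
  ext; simp [mulMatrix]

theorem isIntegral_dualTrace {R : Type*} [CommRing R] [Algebra R A] [Algebra R B]
    [IsScalarTower R A B] (h : ∀ b, ∑ i, l i b • e i = b) {b : B} (hb : IsIntegral R b) :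
    IsIntegral R (dualTrace l e b) := by
  have := isIntegral_trace (isIntegral_mulMatrix (l := l) (e := e) h hb)
  rwa [Matrix.trace, show ∑ i, (mulMatrix l e b).diag i = dualTrace l e b by
    simp [mulMatrix, dualTrace_apply]] at this

/-- A separability idempotent gives a pair of families which is dual with respect to the trace. -/
theorem sum_dualTrace_mul_smul (h : ∀ b, ∑ i, l i b • e i = b) {m : ℕ} (x y : Fin m → B)
    (hxy : ∀ b, ∑ k, (b * x k) ⊗ₜ[A] y k = ∑ k, x k ⊗ₜ[A] (b * y k)) (h1 : ∑ k, x k * y k = 1)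
    (b : B) : ∑ k, dualTrace l e (b * y k) • x k = b := by
  -- Obtained by applying `φ` to the second tensor factor of `hxy`. Summed over the forms `l i`, it
  -- turns the trace expression into `b * ∑ y k * x k = b`.
  have key : ∀ (φ : B →ₗ[A] A) b, ∑ k, φ (b * y k) • x k = ∑ k, φ (y k) • (b * x k) := by
    intro φ b
    have := congrArg (TensorProduct.rid A B ∘ φ.lTensor B) (hxy b)
    simpa using this.symm
  simp_rw [dualTrace_apply, Finset.sum_smul]
  rw [Finset.sum_comm]
  have h2 : ∀ i, ∑ k, l i (b * y k * e i) • x k = b * ∑ k, l i (y k) • (e i * x k) := by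
    intro i
    simp_rw [mul_right_comm b _ (e i), key (l i) (b * e i), Finset.mul_sum, mul_smul_comm,
      mul_assoc]
  simp_rw [h2, ← Finset.mul_sum]
  rw [Finset.sum_comm]
  simp_rw [← smul_mul_assoc, ← Finset.sum_mul, h, mul_comm (y _), h1, mul_one]

variable (A B) in
theorem exists_dualBasis_separability [Module.Finite A B] [Algebra.Etale A B] :
    ∃ (n : ℕ) (l : Fin n → B →ₗ[A] A) (e : Fin n → B) (m : ℕ) (x y : Fin m → B),
      (∀ b, ∑ i, l i b • e i = b) ∧
      (∀ b, ∑ k, (b * x k) ⊗ₜ[A] y k = ∑ k, x k ⊗ₜ[A] (b * y k)) ∧ ∑ k, x k * y k = 1 := by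
  have := Module.FinitePresentation.of_finite_of_finitePresentation A B
  have : Module.Projective A B := Module.Flat.projective_of_finitePresentation
  obtain ⟨n, f, g, -, -, hfg⟩ := Module.Finite.exists_comp_eq_id_of_projective A B
  obtain ⟨z, hz, hz1⟩ := (Algebra.FormallyUnramified.iff_exists_tensorProduct (R := A)
    (S := B)).mp inferInstance
  obtain ⟨m, x, y, rfl⟩ := TensorProduct.exists_sum_tmul_eq z
  refine ⟨n, fun i ↦ LinearMap.proj i ∘ₗ g, fun i ↦ f (Pi.single i 1), m, x, y, fun b ↦ ?_,
    fun b ↦ ?_, by simpa using hz1⟩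
  · conv_rhs => rw [← LinearMap.id_apply (R := A) b, ← hfg, LinearMap.comp_apply,
      pi_eq_sum_univ' (g b)]
    simp
  · have := hz b
    rw [sub_mul, sub_eq_zero] at this
    simpa [Finset.mul_sum] using this.symm

end DualBasis

/-! ### Bounded denominators from the generic fibre -/

section Localization

variable {A₀ B₀ A B : Type*} [CommRing A₀] [CommRing B₀] [CommRing A] [CommRing B]
variable [Algebra A₀ B₀] [Algebra A₀ A] [Algebra B₀ B] [Algebra A B] [Algebra A₀ B]
variable [IsScalarTower A₀ A B] [IsScalarTower A₀ B₀ B]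
variable {t : A₀} [IsLocalization.Away t A] [IsLocalization.Away (algebraMap A₀ B₀ t) B]

include A in
-- All powers of `b` lie in a finitely generated module, which a single `t ^ m` makes integral. Then
-- `(t b) ^ (m + 1) = t * (t ^ m b ^ (m + 1))` is integral.
theorem IsAlmostIntegralElement.isIntegral_smul [Module.Finite A B] {b : B}
    (hb : IsAlmostIntegralElement A₀ b) (t : A₀) [IsLocalization.Away t A] :
    IsIntegral A₀ (t • b) := by
  obtain ⟨N, hN, hbN⟩ := hb
  suffices ∃ m, ∀ x ∈ N, IsIntegral A₀ (t ^ m • x) by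
    obtain ⟨m, hm⟩ := this
    refine IsIntegral.of_pow (n := m + 1) m.succ_pos ?_
    rw [smul_pow, pow_succ', mul_smul]
    exact (hm _ (hbN (Submodule.subset_span ⟨m + 1, rfl⟩))).smul t
  obtain ⟨r, s, rfl⟩ := Submodule.fg_iff_exists_fin_generating_family.mp hN
  have : ∀ i, ∃ m : ℕ, IsIntegral A₀ (t ^ m • s i) := by
    intro i
    obtain ⟨⟨_, m, rfl⟩, hm⟩ := IsIntegral.exists_multiple_integral_of_isLocalization
      (Submonoid.powers t) (Rₘ := A) (s i) (Algebra.IsIntegral.isIntegral _)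
    exact ⟨m, hm⟩
  choose m hm using this
  refine ⟨∑ i, m i, fun x hx ↦ ?_⟩
  induction hx using Submodule.span_induction with
  | mem x hx =>
    obtain ⟨i, rfl⟩ := hx
    rw [← Finset.add_sum_erase _ _ (Finset.mem_univ i), add_comm, pow_add, mul_smul]
    exact (hm i).smul _
  | zero => rw [smul_zero]; exact isIntegral_zero
  | add x y _ _ hx hy => rw [smul_add]; exact hx.add hy
  | smul a x _ hx => rw [smul_comm]; exact hx.smul a

theorem exists_linearMap_lift {R X Y Y' : Type*} [CommRing R] [AddCommGroup X] [Module R X]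
    [AddCommGroup Y] [Module R Y] [AddCommGroup Y'] [Module R Y'] {j : Y →ₗ[R] Y'}
    (hj : Function.Injective j) (g : X →ₗ[R] Y') (hg : ∀ x, ∃ y, j y = g x) :
    ∃ h : X →ₗ[R] Y, ∀ x, j (h x) = g x := by
  choose h hh using hg
  exact ⟨{ toFun := h
           map_add' := fun x y ↦ hj (by simp [hh])
           map_smul' := fun a x ↦ hj (by simp [hh]) }, hh⟩

variable (A B) in
theorem exists_bounded_dual [Module.Finite A B] [Algebra.Etale A B]
    (hinjA : Function.Injective (algebraMap A₀ A)) (hinjB : Function.Injective (algebraMap B₀ B))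
    {c : ℕ} (hc : ∀ x : A, IsIntegral A₀ x → ∃ a, algebraMap A₀ A a = t ^ c • x)
    (hB : ∀ b : B₀, IsAlmostIntegralElement A₀ (algebraMap B₀ B b)) :
    ∃ (k m : ℕ) (τ : Fin m → B₀ →ₗ[A₀] A₀) (e : Fin m → B₀) (K : ℕ) (E : B₀ ⊗[A₀] B₀),
      (∀ b, ∑ i, τ i b • e i = t ^ k • b) ∧
      Algebra.TensorProduct.lmul' A₀ (S := B₀) E = algebraMap A₀ B₀ (t ^ K) ∧
      ∀ b, tensorSquareMap A₀ A B₀ B ((b ⊗ₜ 1) * E) = tensorSquareMap A₀ A B₀ B ((1 ⊗ₜ b) * E) := by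
  obtain ⟨n, l, e, m, x, y, hle, hxy, h1⟩ := exists_dualBasis_separability A B
  obtain ⟨⟨_, r, rfl⟩, hr⟩ := IsLocalization.exist_integer_multiples_of_finite
    (Submonoid.powers (algebraMap A₀ B₀ t)) (Sum.elim x y)
  have hsm : ∀ (s : ℕ) (z : B), (algebraMap A₀ B₀ t ^ s) • z = t ^ s • z := fun s z ↦ by
    rw [← map_pow, algebraMap_smul]
  choose x₀ hx using fun i ↦ hr (.inl i)
  choose y₀ hy using fun i ↦ hr (.inr i)
  simp only [Sum.elim_inl, Sum.elim_inr, hsm] at hx hy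
  let j := (IsScalarTower.toAlgHom A₀ B₀ B).toLinearMap
  -- One factor `t` makes `b * y₀ i` integral, hence also its trace; the other `t ^ c` moves the
  -- trace into `A₀` by preuniformity.
  have lift (i : Fin m) : ∃ τ : B₀ →ₗ[A₀] A₀, ∀ b, algebraMap A₀ A (τ b) =
      t ^ (c + 1) • dualTrace l e (algebraMap B₀ B (b * y₀ i)) := by
    refine exists_linearMap_lift (j := Algebra.linearMap A₀ A) hinjA
      (t ^ (c + 1) • ((dualTrace l e).restrictScalars A₀ ∘ₗ j ∘ₗ LinearMap.mulRight A₀ (y₀ i)))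
      fun b ↦ ?_
    obtain ⟨a, ha⟩ := hc _ (isIntegral_dualTrace (R := A₀) hle
      ((hB (b * y₀ i)).isIntegral_smul (A := A) t))
    refine ⟨a, ha.trans ?_⟩
    rw [← algebraMap_smul A t, map_smul, algebraMap_smul, smul_smul, ← pow_succ]
    rfl
  choose τ hτ using lift
  -- Clearing denominators of `x` and of `y` costs `t ^ r` each, and the trace forms cost `t ^ (c +
  -- 1)`.
  refine ⟨r + r + (c + 1), m, τ, x₀, r + r, ∑ i, x₀ i ⊗ₜ y₀ i, fun b ↦ hinjB ?_, hinjB ?_,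
    fun b ↦ ?_⟩
  · have key := sum_dualTrace_mul_smul hle x y hxy h1 (algebraMap B₀ B b)
    simp only [map_sum, algebraMap_smul_of_square (A' := A), hτ, map_mul, hx, hy]
    conv_rhs => rw [map_pow, ← map_pow, algebraMap_smul, ← key, Finset.smul_sum]
    refine Finset.sum_congr rfl fun i _ ↦ ?_
    rw [mul_smul_comm, ← algebraMap_smul A (t ^ r) (algebraMap B₀ B b * y i), map_smul,
      algebraMap_smul, pow_add, pow_add, ← algebraMap_smul A (t ^ r) (x i)]
    simp only [Algebra.smul_def, map_mul, map_pow, ← IsScalarTower.algebraMap_apply A₀ A B]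
    ring
  · have : ∀ z, algebraMap B₀ B (algebraMap A₀ B₀ z) = algebraMap A₀ B z := fun z ↦
      (IsScalarTower.algebraMap_apply A₀ B₀ B z).symm
    simp only [map_sum, Algebra.TensorProduct.lmul'_apply_tmul, map_mul, hx, hy, this]
    simp only [smul_mul_smul_comm, ← Finset.smul_sum, h1, ← pow_add,
      Algebra.algebraMap_eq_smul_one]
  · simp only [Finset.mul_sum, Algebra.TensorProduct.tmul_mul_tmul, one_mul, map_sum,
      tensorSquareMap_tmul, map_mul, hx, hy]
    have := congrArg (fun z ↦ algebraMap A₀ A (t ^ (r + r)) • z) (hxy (algebraMap B₀ B b))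
    simp only [Finset.smul_sum, pow_add, map_mul, mul_smul] at this
    convert this using 2 with i _ i _
    · rw [← TensorProduct.tmul_smul, algebraMap_smul, TensorProduct.smul_tmul', algebraMap_smul,
        mul_smul_comm]
    · rw [← TensorProduct.tmul_smul, algebraMap_smul, TensorProduct.smul_tmul', algebraMap_smul,
        mul_smul_comm]

variable (A B) in
theorem exists_extension_of_isLocalization (t : A₀) [IsLocalization.Away t A]
    [IsLocalization.Away (algebraMap A₀ B₀ t) B] (φ : B₀ →ₗ[A₀] A₀) :
    ∃ φ' : B →ₗ[A] A, ∀ b, φ' (algebraMap B₀ B b) = algebraMap A₀ A (φ b) := by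
  have : IsLocalization (Algebra.algebraMapSubmonoid B₀ (Submonoid.powers t)) B := by
    rw [Algebra.algebraMapSubmonoid_powers]; infer_instance
  have : IsLocalizedModule (Submonoid.powers t) (IsScalarTower.toAlgHom A₀ B₀ B).toLinearMap :=
    isLocalizedModule_iff_isLocalization.mpr this
  exact ⟨IsLocalizedModule.mapExtendScalars (Submonoid.powers t)
    (IsScalarTower.toAlgHom A₀ B₀ B).toLinearMap (Algebra.linearMap A₀ A) A φ, fun b ↦
    IsLocalizedModule.map_apply (Submonoid.powers t) (IsScalarTower.toAlgHom A₀ B₀ B).toLinearMap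
      (Algebra.linearMap A₀ A) φ b⟩

end Localization

/-! ### The adic completion satisfies the abstract conditions -/

section Completion

open AdicCompletion

variable {A : Type*} [CommRing A] {t : A}

theorem evalₐ_eq_of_le {J : Ideal A} {m n : ℕ} (hmn : m ≤ n) {x : AdicCompletion J A} {a : A}
    (h : evalₐ J n x = Ideal.Quotient.mk _ a) : evalₐ J m x = Ideal.Quotient.mk _ a := by
  obtain ⟨x, rfl⟩ := mk_surjective _ _ x
  rw [evalₐ_mk] at h ⊢
  rw [← AdicCompletion.Ideal.mk_eq_mk J hmn x, Ideal.Quotient.eq]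
  exact Ideal.pow_le_pow_right hmn (Ideal.Quotient.eq.mp h)

theorem exists_evalₐ_eq {J : Ideal A} (n : ℕ) (x : AdicCompletion J A) :
    ∃ a, evalₐ J n x = Ideal.Quotient.mk _ a := by
  obtain ⟨a, ha⟩ := Ideal.Quotient.mk_surjective (evalₐ J n x)
  exact ⟨a, ha.symm⟩

theorem evalₐ_algebraMap {J : Ideal A} (n : ℕ) (a : A) :
    evalₐ J n (algebraMap A (AdicCompletion J A) a) = Ideal.Quotient.mk _ a :=
  (evalₐ J n).commutes a

theorem isAdicApproximation_adicCompletion (ht : ∀ x : A, t * x = 0 → x = 0) :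
    IsAdicApproximation t (Algebra.linearMap A (AdicCompletion (Ideal.span {t}) A)) where
  regular := ht
  regular' x hx := by
    refine ext_evalₐ fun n ↦ ?_
    -- One level higher is needed: `t a ∈ t ^ (n + 1) A` yields `a ∈ t ^ n A`.
    obtain ⟨a, ha⟩ := exists_evalₐ_eq (n + 1) x
    have h := congrArg (evalₐ (Ideal.span {t}) (n + 1)) hx
    rw [map_smul, ha, _root_.map_zero, ← Ideal.Quotient.mk_eq_mk, ← Submodule.Quotient.mk_smul,
      Ideal.Quotient.mk_eq_mk, Ideal.Quotient.eq_zero_iff_mem, Ideal.span_singleton_pow,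
      Ideal.mem_span_singleton'] at h
    obtain ⟨c, hc⟩ := h
    rw [evalₐ_eq_of_le n.le_succ ha, _root_.map_zero, Ideal.Quotient.eq_zero_iff_mem,
      Ideal.span_singleton_pow, Ideal.mem_span_singleton']
    refine ⟨c, sub_eq_zero.mp (ht _ ?_)⟩
    rw [mul_sub, sub_eq_zero, ← smul_eq_mul t a, ← hc]
    ring
  approx n x := by
    obtain ⟨a, ha⟩ := exists_evalₐ_eq n x
    have h : x - algebraMap A _ a ∈ (Ideal.span {t} ^ n • ⊤ :
        Submodule A (AdicCompletion (Ideal.span {t}) A)) := by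
      rw [pow_smul_top_eq_ker_eval (Submodule.fg_span_singleton t), LinearMap.mem_ker,
        ← factor_evalₐ_eq_eval _ _ (by simp), map_sub, ha, evalₐ_algebraMap, sub_self, _root_.map_zero]
    rw [Ideal.span_singleton_pow, Submodule.ideal_span_singleton_smul,
      Submodule.mem_smul_pointwise_iff_exists] at h
    obtain ⟨y, -, hy⟩ := h
    exact ⟨a, y, by rw [hy, Algebra.linearMap_apply, add_sub_cancel]⟩
  detect n a y h := by
    have h := congrArg (evalₐ (Ideal.span {t}) n) h
    obtain ⟨b, hb⟩ := exists_evalₐ_eq n y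
    rw [Algebra.linearMap_apply, evalₐ_algebraMap, map_smul, hb, ← Ideal.Quotient.mk_eq_mk,
      ← Ideal.Quotient.mk_eq_mk, ← Submodule.Quotient.mk_smul, Ideal.Quotient.mk_eq_mk,
      Ideal.Quotient.mk_eq_mk, Ideal.Quotient.eq, Ideal.span_singleton_pow,
      Ideal.mem_span_singleton'] at h
    obtain ⟨c, hc⟩ := h
    exact ⟨c + b, by rw [smul_eq_mul, mul_add, mul_comm _ c, hc, smul_eq_mul, sub_add_cancel]⟩

variable {B : Type*} [CommRing B] [Algebra A B]

theorem IsAdicApproximation.restrictScalars {B' : Type*} [CommRing B'] [Algebra B B'] [Algebra A B']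
    [IsScalarTower A B B']
    (h : IsAdicApproximation (algebraMap A B t) (Algebra.linearMap B B')) :
    IsAdicApproximation t (IsScalarTower.toAlgHom A B B').toLinearMap where
  regular x hx := h.regular x (by rwa [algebraMap_smul])
  regular' x hx := h.regular' x (by rwa [algebraMap_smul])
  approx n x := by
    obtain ⟨a, y, hy⟩ := h.approx n x
    exact ⟨a, y, by rwa [← map_pow, algebraMap_smul] at hy⟩
  detect n a y hy := by
    obtain ⟨b, hb⟩ := h.detect n a y (by rw [← map_pow, algebraMap_smul]; exact hy)
    exact ⟨b, by rwa [← map_pow, algebraMap_smul] at hb⟩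

/-- An `A`-linear form sends `t ^ n B` into `t ^ n A`. Its completion is obtained as a bare function
determined by its reductions, from which linearity is deduced later. -/
theorem exists_adicCompletion_map (l : B →ₗ[A] A) : ∃ l' :
    AdicCompletion (Ideal.span {algebraMap A B t}) B → AdicCompletion (Ideal.span {t}) A,
    ∀ n x b, evalₐ _ n x = Ideal.Quotient.mk _ b → evalₐ _ n (l' x) = Ideal.Quotient.mk _ (l b) := by
  have hl : ∀ n b c, Ideal.Quotient.mk (Ideal.span {algebraMap A B t} ^ n) b =
      Ideal.Quotient.mk _ c → l b - l c ∈ Ideal.span {t} ^ n := by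
    intro n b c h
    rw [Ideal.Quotient.eq, Ideal.span_singleton_pow, Ideal.mem_span_singleton'] at h
    obtain ⟨d, hd⟩ := h
    rw [← map_sub, ← hd, mul_comm, ← map_pow, ← Algebra.smul_def, map_smul,
      Ideal.span_singleton_pow]
    exact Ideal.mul_mem_right _ _ (Ideal.mem_span_singleton_self _)
  choose c hc using fun (x : AdicCompletion (Ideal.span {algebraMap A B t}) B) (n : ℕ) ↦
    exists_evalₐ_eq n x
  refine ⟨fun x ↦ AdicCompletion.mk _ _ (AdicCauchySequence.mk _ _ (fun n ↦ l (c x n)) fun n ↦ ?_),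
    fun n x b hb ↦ ?_⟩
  · rw [SModEq.sub_mem, smul_eq_mul, Ideal.mul_top]
    exact hl n _ _ ((hc x n).symm.trans (evalₐ_eq_of_le n.le_succ (hc x (n + 1))))
  · rw [evalₐ_mk, Ideal.Quotient.eq]
    exact hl n _ _ ((hc x n).symm.trans hb)

variable [Algebra (AdicCompletion (Ideal.span {t}) A)
  (AdicCompletion (Ideal.span {algebraMap A B t}) B)]

theorem isAdicSquare_adicCompletion (htA : ∀ x : A, t * x = 0 → x = 0)
    (htB : ∀ x : B, algebraMap A B t * x = 0 → x = 0)
    (hmap : ∀ (n : ℕ) (x : AdicCompletion (Ideal.span {t}) A) (a : A),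
      evalₐ _ n x = Ideal.Quotient.mk _ a →
      evalₐ _ n (algebraMap _ (AdicCompletion (Ideal.span {algebraMap A B t}) B) x) =
        Ideal.Quotient.mk _ (algebraMap A B a)) {k n : ℕ} {l : Fin n → B →ₗ[A] A} {e : Fin n → B}
    (he : ∀ b, ∑ i, l i b • e i = t ^ k • b) :
    IsAdicSquare A (AdicCompletion (Ideal.span {t}) A) B
      (AdicCompletion (Ideal.span {algebraMap A B t}) B) t where
  left := isAdicApproximation_adicCompletion htA
  right := (isAdicApproximation_adicCompletion htB).restrictScalars
  bounded := by
    choose l' hl' using fun i ↦ exists_adicCompletion_map (t := t) (l i)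
    refine ⟨k, n, l, fun i ↦
      { toFun := l' i
        map_add' := fun x y ↦ ext_evalₐ fun m ↦ ?_
        map_smul' := fun a x ↦ ext_evalₐ fun m ↦ ?_ }, e, fun i b ↦ ?_,
      he, fun x ↦ ?_⟩
    · obtain ⟨b, hb⟩ := exists_evalₐ_eq m x
      obtain ⟨c, hc⟩ := exists_evalₐ_eq m y
      rw [map_add, hl' i m x b hb, hl' i m y c hc, hl' i m (x + y) (b + c) (by simp [hb, hc]),
        map_add, map_add]
    · obtain ⟨b, hb⟩ := exists_evalₐ_eq m x
      obtain ⟨c, hc⟩ := exists_evalₐ_eq m a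
      rw [RingHom.id_apply, smul_eq_mul, map_mul, hl' i m x b hb, hc,
        hl' i m (a • x) (c • b) (by
          rw [Algebra.smul_def, map_mul, hmap m a c hc, hb, Algebra.smul_def, map_mul]),
        map_smul, smul_eq_mul, map_mul]
    · exact ext_evalₐ fun m ↦ (hl' i m _ b (evalₐ_algebraMap m b)).trans (evalₐ_algebraMap m _).symm
    · refine ext_evalₐ fun m ↦ ?_
      obtain ⟨b, hb⟩ := exists_evalₐ_eq m x
      have h1 : ∀ i, evalₐ (Ideal.span {algebraMap A B t}) m
          (l' i x • algebraMap B _ (e i)) = Ideal.Quotient.mk _ (l i b • e i) := fun i ↦ by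
        rw [Algebra.smul_def, map_mul, hmap m _ _ (hl' i m x b hb), evalₐ_algebraMap,
          Algebra.smul_def, map_mul]
      rw [map_sum]
      refine (Finset.sum_congr rfl fun i _ ↦ h1 i).trans ?_
      rw [← map_sum, he, Algebra.smul_def, map_mul, Algebra.smul_def, map_mul,
        ← map_pow (algebraMap A (AdicCompletion (Ideal.span {t}) A)),
        hmap m _ _ (evalₐ_algebraMap m _), hb]

end Completion

/-! ### Extracting bounded data from `(*)` -/

section Star

theorem associated_of_span_singleton_eq {A : Type*} [CommRing A] {s t : A}
    (hs : s ∈ nonZeroDivisors A) (h : Ideal.span {t} = Ideal.span {s}) : Associated s t := by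
  obtain ⟨c, hc⟩ := Ideal.mem_span_singleton'.mp (h ▸ Ideal.mem_span_singleton_self t)
  obtain ⟨d, hd⟩ := Ideal.mem_span_singleton'.mp (h ▸ Ideal.mem_span_singleton_self s)
  have hdc : c * d = 1 := by
    rw [← sub_eq_zero]
    refine (mem_nonZeroDivisors_iff.mp hs).1 _ ?_
    rw [mul_sub, mul_one, sub_eq_zero]
    conv_rhs => rw [← hd, ← hc]
    ring
  exact ⟨⟨c, d, hdc, by rw [mul_comm, hdc]⟩, by rw [mul_comm]; exact hc⟩

theorem SatisfiesStar.exists_bounded {A₀ : Type uA} [CommRing A₀] {B₀ : Type uB} [CommRing B₀]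
    {f : A₀ →+* B₀} {t : A₀} (h : SatisfiesStar f (Ideal.span {t}) (Ideal.span {f t})) :
    letI := f.toAlgebra
    (∀ x : A₀, t * x = 0 → x = 0) ∧ (∀ x : B₀, f t * x = 0 → x = 0) ∧
    ∃ (k m : ℕ) (l : Fin m → B₀ →ₗ[A₀] A₀) (e : Fin m → B₀) (K : ℕ) (E : B₀ ⊗[A₀] B₀),
      (∀ b, ∑ i, l i b • e i = t ^ k • b) ∧
      Algebra.TensorProduct.lmul' A₀ (S := B₀) E = algebraMap A₀ B₀ (t ^ K) ∧
      ∀ J : Ideal A₀, J = J ^ 2 → J ≤ factorIdeal A₀ B₀ → ∀ ε ∈ J, ∀ b : B₀,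
        ε • ((b ⊗ₜ[A₀] 1) * E) = ε • ((1 ⊗ₜ[A₀] b) * E) := by
  let : Algebra A₀ B₀ := f.toAlgebra
  obtain ⟨t₁, ht₁, -, ⟨s, hs, hts, c, -, hc⟩, ⟨hfin, het⟩, htor, hint⟩ := h
  -- `(*)` and preuniformity each come with their own generator of the ideal; `s`, `t₁` and `t` are
  -- associated, so their localizations can be identified.
  have hst : Associated s t := associated_of_span_singleton_eq hs hts
  have hst₁ : Associated s t₁ := associated_of_span_singleton_eq hs (ht₁.symm.trans hts)
  have htt₁ : Associated t₁ t := hst₁.symm.trans hst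
  obtain ⟨u, hu⟩ := hst
  have htA : ∀ x : A₀, t * x = 0 → x = 0 := fun x hx ↦
    (mem_nonZeroDivisors_iff.mp hs).1 x (by
      rw [← hu, mul_right_comm] at hx
      exact u.isUnit.mul_left_eq_zero.mp hx)
  have htB : ∀ x : B₀, f t * x = 0 → x = 0 := fun x hx ↦ htor x (by
    obtain ⟨v, hv⟩ := htt₁
    rw [← hv, map_mul, mul_right_comm] at hx
    exact (v.isUnit.map f).mul_left_eq_zero.mp hx)
  refine ⟨htA, htB, ?_⟩
  let A := Localization.Away t₁
  let B := Localization.Away (f t₁)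
  let : Algebra A B := (Localization.awayMap f t₁).toAlgebra
  have : Module.Finite A B := hfin
  have : Algebra.Etale A B := het
  have : IsScalarTower A₀ A B := .of_algebraMap_eq fun x ↦ by
    rw [IsScalarTower.algebraMap_apply A₀ B₀ B]
    change _ = IsLocalization.Away.map A B f t₁ _
    rw [IsLocalization.Away.map, IsLocalization.map_eq]
    rfl
  have : IsLocalization.Away t A := IsLocalization.Away.of_associated htt₁
  have : IsLocalization.Away (algebraMap A₀ B₀ t) B :=
    IsLocalization.Away.of_associated (htt₁.map f)
  have hinjA : Function.Injective (algebraMap A₀ A) := by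
    refine IsLocalization.injective A (M := Submonoid.powers t) ?_
    rw [Submonoid.powers_le, mem_nonZeroDivisors_iff]
    exact ⟨htA, fun x hx ↦ htA x (by rwa [mul_comm])⟩
  have hinjB : Function.Injective (algebraMap B₀ B) := by
    refine IsLocalization.injective B (M := Submonoid.powers (algebraMap A₀ B₀ t)) ?_
    rw [Submonoid.powers_le, mem_nonZeroDivisors_iff]
    exact ⟨htB, fun x hx ↦ htB x (by rw [mul_comm]; exact hx)⟩
  have : IsLocalization.Away s A := IsLocalization.Away.of_associated hst₁.symm
  let ψ : Localization.Away s ≃ₐ[A₀] A :=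
    IsLocalization.algEquiv (Submonoid.powers s) (Localization.Away s) A
  have hc' : ∀ x : A, IsIntegral A₀ x → ∃ a, algebraMap A₀ A a = t ^ c • x := by
    intro x hx
    obtain ⟨a, ha⟩ := hc (ψ.symm x) (hx.map ψ.symm)
    have := congrArg ψ ha
    rw [map_mul, map_pow, ψ.commutes, ψ.commutes, ψ.apply_symm_apply] at this
    refine ⟨u ^ c * a, ?_⟩
    rw [map_mul, this, ← hu, Algebra.smul_def, mul_pow, map_mul, map_pow, map_pow]
    ring
  obtain ⟨k, m, l, e, K, E, h1, h2, h3⟩ := exists_bounded_dual A B (t := t) hinjA hinjB hc' hint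
  refine ⟨k, m, l, e, K, E, h1, h2, fun J hJ hJB ε hε b ↦ ?_⟩
  rw [← sub_eq_zero, ← smul_sub]
  -- The commutation rule for `E` holds after inverting `t`, and the kernel of the map to `B ⊗[A] B`
  -- is killed by `J`.
  refine smul_eq_zero_of_tensorSquareMap (A' := A) (B' := B) hJ hJB hinjA
    (exists_extension_of_isLocalization A B t) ?_ hε
  rw [map_sub, h3, sub_self]

end Star

/-! ### The comparison theorem -/

section Main

variable {R : Type uR} [CommRing R] {I : Ideal R}
variable {A₀ : Type uA} [CommRing A₀] [Algebra R A₀] {B₀ : Type uB} [CommRing B₀] [Algebra R B₀]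

theorem isAlmostFinitelyGeneratedProjective_iff (hI : I = I ^ 2) (f : A₀ →ₐ[R] B₀) :
    IsAlmostFinitelyGeneratedProjective I f ↔
      letI := f.toRingHom.toAlgebra
      I.map (algebraMap R A₀) ≤ factorIdeal A₀ B₀ := by
  let := f.toRingHom.toAlgebra
  exact (almostFinitelyGenerated_and_almostProjective_iff A₀ B₀ I hI).trans
    Ideal.map_le_iff_le_comap.symm

theorem isAlmostFiniteEtale_iff (hI : I = I ^ 2) (f : A₀ →ₐ[R] B₀) :
    IsAlmostFiniteEtale I f ↔
      letI := f.toRingHom.toAlgebra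
      I.map (algebraMap R A₀) ≤ factorIdeal A₀ B₀ ∧
        I.map (algebraMap R A₀) ≤ unramifiedIdeal A₀ B₀ := by
  let := f.toRingHom.toAlgebra
  have : IsScalarTower R A₀ B₀ := .of_algebraMap_eq fun r ↦ (f.commutes r).symm
  have h1 := almostFlat_and_almostFinitelyPresented_iff A₀ B₀ I hI
  have h2 := almostProjective_tensorProduct_iff (I := I) (A := A₀) (B := B₀)
  rw [Ideal.map_le_iff_le_comap, Ideal.map_le_iff_le_comap, ← h1, ← h2]
  exact and_right_comm

theorem evalₐ_completionMap (f : A₀ →ₐ[R] B₀) (t : A₀) (n : ℕ)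
    (x : AdicCompletion (Ideal.span {t}) A₀) (a : A₀)
    (h : AdicCompletion.evalₐ _ n x = Ideal.Quotient.mk _ a) :
    AdicCompletion.evalₐ _ n (completionMap f t x) = Ideal.Quotient.mk _ (f a) := by
  rw [completionMap, AdicCompletion.evalₐ_liftAlgHom]
  · rw [AlgHom.comp_apply, AlgHom.restrictScalars_apply, h]
    rfl
  · intro m n hle
    ext y
    obtain ⟨b, hb⟩ := exists_evalₐ_eq n y
    simp only [AlgHom.comp_apply, AlgHom.restrictScalars_apply, hb, evalₐ_eq_of_le hle hb]
    rfl

end Main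
end AlmostPurity

open AlmostPurity in
theorem mainTheorem2 {R : Type uR} [CommRing R] (I : Ideal R) (hI : AlmostPurity.IsBasicSetup I)
    {A₀ : Type uA} [CommRing A₀] [Algebra R A₀] {B₀ : Type uB} [CommRing B₀] [Algebra R B₀]
    (f₀ : A₀ →ₐ[R] B₀) (t : A₀)
    (hf₀ : AlmostPurity.SatisfiesStar (f₀ : A₀ →+* B₀) (Ideal.span {t}) (Ideal.span {f₀ t})) :
    (AlmostPurity.IsAlmostFinitelyGeneratedProjective I f₀ ↔
      AlmostPurity.IsAlmostFinitelyGeneratedProjective I (AlmostPurity.completionMap f₀ t)) ∧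
    (AlmostPurity.IsAlmostFiniteEtale I f₀ ↔
      AlmostPurity.IsAlmostFiniteEtale I (AlmostPurity.completionMap f₀ t)) := by
  rw [isAlmostFinitelyGeneratedProjective_iff hI.idempotent,
    isAlmostFinitelyGeneratedProjective_iff hI.idempotent,
    isAlmostFiniteEtale_iff hI.idempotent, isAlmostFiniteEtale_iff hI.idempotent]
  let : Algebra A₀ B₀ := f₀.toRingHom.toAlgebra
  let A' := AdicCompletion (Ideal.span {t}) A₀
  let B' := AdicCompletion (Ideal.span {algebraMap A₀ B₀ t}) B₀
  let φ : A' →ₐ[R] B' := completionMap f₀ t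
  let : Algebra A' B' := φ.toRingHom.toAlgebra
  obtain ⟨htA, htB, k, m, l, e, K, E, he, hμ, hE⟩ := hf₀.exists_bounded
  have hφ := evalₐ_completionMap f₀ t
  have : IsScalarTower A₀ A' B' := .of_algebraMap_eq fun a ↦ AdicCompletion.ext_evalₐ fun n ↦
    (evalₐ_algebraMap n (algebraMap A₀ B₀ a)).trans (hφ n _ a (evalₐ_algebraMap n a)).symm
  have H : IsAdicSquare A₀ A' B₀ B' t := isAdicSquare_adicCompletion htA htB hφ he
  obtain ⟨J, hJdef⟩ : ∃ J, J = I.map (algebraMap R A₀) := ⟨_, rfl⟩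
  rw [← hJdef]
  have hJ : J = J ^ 2 := by rw [hJdef, ← Ideal.map_pow, ← hI.idempotent]
  have hmap : I.map (algebraMap R A') = J.map (algebraMap A₀ A') := by
    rw [hJdef, Ideal.map_map, ← IsScalarTower.algebraMap_eq]
  have h1 : J ≤ factorIdeal A₀ B₀ ↔ I.map (algebraMap R A') ≤ factorIdeal A' B' := by
    rw [hmap, Ideal.map_le_iff_le_comap, H.comap_factorIdeal]
  -- The comparison of diagonal idempotents works only up to torsion that must be almost zero, so it
  -- is conditional on the first comparison.
  have h2 (h : J ≤ factorIdeal A₀ B₀) :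
      J ≤ unramifiedIdeal A₀ B₀ ↔ I.map (algebraMap R A') ≤ unramifiedIdeal A' B' := by
    rw [hmap, Ideal.map_le_iff_le_comap]
    exact ⟨H.le_comap_unramifiedIdeal hJ h, H.le_unramifiedIdeal hJ h hμ (hE J hJ h)⟩
  exact ⟨h1, ⟨fun h ↦ ⟨h1.mp h.1, (h2 h.1).mp h.2⟩,
    fun h ↦ ⟨h1.mpr h.1, (h2 (h1.mpr h.1)).mpr h.2⟩⟩⟩
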